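/- Let $\mathcal X$ be a finite set and $K:\mathcal X\times\mathcal X\to[0,\infty)$ an irreducible Markov kernel, reversible with respect to its invariant probability distribution $\varpi$, i.e. $K(x,y)\varpi(x)=K(y,x)\varpi(y)$. Let $\mathcal M=[0,\infty)^{\mathcal X}$, let $a,b>0$, and let $p\in(0,\infty)^{\mathcal X}$ satisfy $\sum_x p(x)\varpi(x)=1$. Write $\langle\phi,\psi\rangle_\varpi=\sum_x\phi(x)\psi(x)\varpi(x)$, $\nabla\psi(x,y)=\psi(y)-\psi(x)$, $\theta(u,v)=\int_0^1u^\xi v^{1-\xi}\,d\xi$ (the logarithmic mean), and, for $\mu\in\mathcal M$, $\hat\mu(x,y)=\theta(\mu(x),\mu(y))$ and $$\|\Phi\|_\mu^2=\tfrac12\sum_{x,y}\Phi(x,y)^2\,\hat\mu(x,y)K(x,y)\varpi(x)\qquad(\Phi\in\mathbb R^{\mathcal X\times\mathcal X}).$$ For $\mu_0,\mu_1\in\mathcal M$ define $\mathcal W_p^{a,b}(\mu_0,\mu_1)\ge0$ by $$\mathcal W_p^{a,b}(\mu_0,\mu_1)^2=\inf\Big\{a^2\int_0^1h_t^2\,dt+b^2\int_0^1\|\nabla\psi_t\|_{\mu_t}^2\,dt\Big\},$$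 where the infimum is over all triples $(\mu_t,\psi_t,h_t)_{t\in[0,1]}$ such that $t\mapsto\mu_t\in\mathcal M$ is absolutely continuous and equals the given $\mu_0$ and $\mu_1$ at $t=0$ and $t=1$, $t\mapsto\psi_t\in\mathbb R^{\mathcal X}$ and $t\mapsto h_t\in\mathbb R$ are measurable, and for a.e. $t\in[0,1]$ and all $x\in\mathcal X$ $$\dot\mu_t(x)+\sum_{y}(\psi_t(y)-\psi_t(x))\,\hat\mu_t(x,y)K(x,y)=h_t\,p(x).$$ A function $\phi\in H^1((0,1);\mathbb R^{\mathcal X})$ (identified with its continuous representative on $[0,1]$) is called a Hamilton--Jacobi subsolution if for a.e. $t\in(0,1)$ $$\langle\dot\phi_t,\mu\rangle_\varpi+\frac1{2b^2}\|\nabla\phi_t\|_\mu^2\le0\qquad\text{for all }\mu\in\mathcal M.$$ **Theorem (Duality formula).** For all $\mu_0,\mu_1\in\mathcal M$, the value $\mathcal W_p^{a,b}(\mu_0,\mu_1)$ is finite and $$\tfrac12\,\mathcal W_p^{a,b}(\mu_0,\mu_1)^2=\sup_\phi\Big\{\langle\phi_1,\mu_1\rangle_\varpi-\langle\phi_0,\mu_0\rangle_\varpi-\frac1{2a^2}\int_0^1\langle\phi_t,p\rangle_\varpi^2\,dt\Big\},$$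 where the supremum is over all Hamilton--Jacobi subsolutions $\phi\in H^1((0,1);\mathbb R^{\mathcal X})$. The same identity holds when the supremum is taken only over the Hamilton--Jacobi subsolutions $\phi\in C^1([0,1];\mathbb R^{\mathcal X})$. -/

import Mathlib

open MeasureTheory Set
open scoped ENNReal

noncomputable section

/-- A finite irreducible Markov chain on `X` with transition kernel `K`, reversible with respect to
its invariant probability distribution `ϖ`. -/
structure RevChain (X : Type*) [Fintype X] where
  K : Matrix X X ℝ
  ϖ : X → ℝ
  irreducible : K.IsIrreducible
  row_sum : ∀ x, ∑ y, K x y = 1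
  ϖ_nonneg : ∀ x, 0 ≤ ϖ x
  ϖ_sum : ∑ x, ϖ x = 1
  invariant : ∀ x, ϖ x = ∑ y, ϖ y * K y x
  reversible : ∀ x y, K x y * ϖ x = K y x * ϖ y

/-- The cone `𝓜` of nonnegative densities on `X`. -/
def nonnegDensities (X : Type*) : Set (X → ℝ) := {μ | ∀ x, 0 ≤ μ x}

/-- The strictly positive densities `𝓜₊` on `X`. -/
def posDensities (X : Type*) : Set (X → ℝ) := {μ | ∀ x, 0 < μ x}

/-- The discrete gradient `∇ψ(x,y) = ψ(y) - ψ(x)`. -/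
def grad {X : Type*} (ψ : X → ℝ) : X → X → ℝ := fun x y => ψ y - ψ x

/-- The logarithmic mean `θ(u,v) = ∫₀¹ u^ξ v^(1-ξ) dξ` of `u, v ≥ 0`. -/
def logMean (u v : ℝ) : ℝ := ∫ ξ in (0 : ℝ)..1, u ^ ξ * v ^ (1 - ξ)

/-- The mobility `μ̂(x,y) = θ(μ(x),μ(y))`. -/
def mobility {X : Type*} (μ : X → ℝ) : X → X → ℝ := fun x y => logMean (μ x) (μ y)

namespace RevChain

variable {X : Type*} [Fintype X] (C : RevChain X)

/-- `⟨φ,ψ⟩_ϖ = ∑ₓ φ(x) ψ(x) ϖ(x)`. -/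
def pairing (φ ψ : X → ℝ) : ℝ := ∑ x, φ x * ψ x * C.ϖ x

/-- The total mass `‖ψ‖_{ϖ,1} = ∑ₓ ϖ(x) |ψ(x)|`. -/
def l1Norm (ψ : X → ℝ) : ℝ := ∑ x, C.ϖ x * |ψ x|

/-- The discrete divergence of `Ψ : X × X → ℝ`. -/
def divergence (Ψ : X → X → ℝ) : X → ℝ :=
  fun x => 1 / 2 * ∑ y, (Ψ x y - Ψ y x) * C.K x y

/-- `⟨Φ,Ψ⟩_μ = ½ ∑_{x,y} Φ(x,y) Ψ(x,y) μ̂(x,y) K(x,y) ϖ(x)`. -/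
def innerMu (μ : X → ℝ) (Φ Ψ : X → X → ℝ) : ℝ :=
  1 / 2 * ∑ x, ∑ y, Φ x y * Ψ x y * mobility μ x y * C.K x y * C.ϖ x

/-- `‖Φ‖_μ = √⟨Φ,Φ⟩_μ`. -/
def normMu (μ : X → ℝ) (Φ : X → X → ℝ) : ℝ := √(C.innerMu μ Φ Φ)

/-- `C.IsAdmissible p μ₀ μ₁ μ ψ h`: the triple `(μ_t, ψ_t, h_t)_{t ∈ [0,1]}` belongs to
`CE_p(μ₀, μ₁; [0,1])`. Only the values at times in `[0,1]` matter; the derivative of `μ` exists at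
almost every time, as `μ` is absolutely continuous. -/
structure IsAdmissible (p μ₀ μ₁ : X → ℝ) (μ ψ : ℝ → X → ℝ) (h : ℝ → ℝ) : Prop where
  nonneg : ∀ t ∈ Icc (0 : ℝ) 1, μ t ∈ nonnegDensities X
  absCont : ∀ x, AbsolutelyContinuousOnInterval (fun t => μ t x) 0 1
  measurable_ψ : Measurable ψ
  measurable_h : Measurable h
  continuity_eq : ∀ᵐ t ∂volume.restrict (Icc (0 : ℝ) 1), ∀ x,
    deriv (fun s => μ s x) t
      + C.divergence (fun y z => mobility (μ t) y z * grad (ψ t) y z) x = h t * p x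
  start : μ 0 = μ₀
  finish : μ 1 = μ₁

/-- The action `a² ∫₀¹ h_t² dt + b² ∫₀¹ ‖∇ψ_t‖²_{μ_t} dt ∈ [0,∞]`. -/
def action (a b : ℝ) (μ ψ : ℝ → X → ℝ) (h : ℝ → ℝ) : ℝ≥0∞ :=
  ENNReal.ofReal (a ^ 2) * (∫⁻ t in Icc (0 : ℝ) 1, ENNReal.ofReal (h t ^ 2))
    + ENNReal.ofReal (b ^ 2)
      * (∫⁻ t in Icc (0 : ℝ) 1, ENNReal.ofReal (C.normMu (μ t) (grad (ψ t)) ^ 2))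

/-- The transport distance `𝓦_p^{a,b}(μ₀, μ₁)`, the square root of the minimal action. -/
def dist (a b : ℝ) (p μ₀ μ₁ : X → ℝ) : ℝ≥0∞ :=
  (⨅ (μ : ℝ → X → ℝ) (ψ : ℝ → X → ℝ) (h : ℝ → ℝ) (_ : C.IsAdmissible p μ₀ μ₁ μ ψ h),
    C.action a b μ ψ h) ^ (1 / 2 : ℝ)

/-- The Hamilton–Jacobi inequality
`⟨φ̇_t,μ⟩_ϖ + (1/(2b²)) ‖∇φ_t‖²_μ ≤ 0` for a.e. `t ∈ (0,T)` and all `μ ∈ 𝓜`. -/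
def SatisfiesHJ (T b : ℝ) (φ : ℝ → X → ℝ) : Prop :=
  ∀ᵐ t ∂volume.restrict (Ioo (0 : ℝ) T), ∀ μ ∈ nonnegDensities X,
    C.pairing (fun x => deriv (fun s => φ s x) t) μ
      + 1 / (2 * b ^ 2) * C.normMu μ (grad (φ t)) ^ 2 ≤ 0

end RevChain

/-- `φ ∈ H¹((0,T); ℝ^X)`, where `φ` is the representative that is continuous on `[0,T]`: it is
absolutely continuous on `[0,T]`, with derivative (the weak derivative) in `L²(0,T)`. -/
def IsH1 {X : Type*} (T : ℝ) (φ : ℝ → X → ℝ) : Prop :=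
  ∀ x, AbsolutelyContinuousOnInterval (fun t => φ t x) 0 T ∧
    MemLp (deriv fun t => φ t x) 2 (volume.restrict (Ioo 0 T))

/-- `φ ∈ C¹([0,T]; ℝ^X)`. -/
def IsC1 {X : Type*} (T : ℝ) (φ : ℝ → X → ℝ) : Prop :=
  ∀ x, ContDiffOn ℝ 1 (fun t => φ t x) (Icc 0 T)

namespace RevChain

variable {X : Type*} [Fintype X] (C : RevChain X)

/-- The set of Hamilton–Jacobi subsolutions of class `H¹` on `(0,T)`. -/
def HJ (T b : ℝ) : Set (ℝ → X → ℝ) := {φ | IsH1 T φ ∧ C.SatisfiesHJ T b φ}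

/-- The dual functional
`⟨φ₁,μ₁⟩_ϖ - ⟨φ₀,μ₀⟩_ϖ - (1/(2a²)) ∫₀¹ ⟨φ_t,p⟩²_ϖ dt`. -/
def dualValue (a : ℝ) (p μ₀ μ₁ : X → ℝ) (φ : ℝ → X → ℝ) : ℝ :=
  C.pairing (φ 1) μ₁ - C.pairing (φ 0) μ₀
    - 1 / (2 * a ^ 2) * ∫ t in (0 : ℝ)..1, C.pairing (φ t) p ^ 2

end RevChain

end

/-!
The inequality `≥` is weak duality (`RevChain.dualValue_le_action`): along an admissible triple, the
derivative of `⟨φ_t, μ_t⟩` is computed by the product rule and the continuity equation, and bounded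
by the Hamilton–Jacobi inequality and Young's inequality.

For the inequality `≤`, the dual problem is discretised in time. A discrete potential is a family
of nodes `φ_0, …, φ_n`, and the Hamilton–Jacobi inequality is imposed on the increment
`φ_{k+1} - φ_k` with the energy of either end of the cell, with one multiplier for each: `m_k ≥ 0`
and `m'_k ≥ 0`. The Lagrangian is a quadratic function of the nodes, in which the multipliers enter
through `m_k + m'_k` and through the concave mobilities `θ(m_k + ε)`, `θ(m'_k + ε)`. It is concave
in the nodes and convex in the multipliers, and the floor `ε > 0` makes its superlevel sets in the
nodes compact, so that a minimax principle (`exists_forall_le_of_forall_exists_lt`) applies.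

On the dual side, the linear interpolation of feasible nodes is a subsolution in integrated form,
by convexity of the energy, and the trapezoidal rule overestimates the integral of `⟨φ_t, p⟩²`; a
damped time average turns it into a `C¹` subsolution of nearly the same dual value
(`RevChain.exists_isC1_dualValue_gt`). Hence an upper bound for the dual values of the `C¹`
subsolutions bounds the discrete dual problem, and the minimax principle gives multipliers with a
stationary point of the Lagrangian whose quadratic part obeys the same bound
(`RevChain.exists_discrete_saddle`).

On the primal side, stationarity says that a discrete curve which makes two half steps in each
cell, with weights `θ(m_k + ε)` and `θ(m'_k + ε)`, leads from `μ₀` to `μ₁` and takes the value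
`m_k + m'_k` in the middle of the cell (`RevChain.discreteCurve_of_stationary`). The multipliers
are bounded uniformly in `n` by conservation of mass (`RevChain.multiplier_le_of_saddle`), so the
half steps become small. Raised by a small multiple of `p`, the segment over a cell lies above
`(m_k + ε) + (m'_k + ε)`; as the logarithmic mean is monotone and superadditive, its mobility
dominates the sum of the two weights. Solving a Poisson equation at each time realises the segment
at a cost not larger than that of the two half steps (`RevChain.joins_cell`). The ramps from `μ₀`
and to `μ₁` use the source alone and are cheap (`RevChain.joins_source`); the same construction
shows that the distance is finite (`RevChain.exists_joins`).
-/

noncomputable section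

/-! ### The logarithmic mean -/

section LogMean

variable {u v u' v' : ℝ}

lemma rpow_mul_rpow_one_sub_le_add (hu : 0 ≤ u) (hv : 0 ≤ v) {ξ : ℝ} (hξ : ξ ∈ Icc (0 : ℝ) 1) :
    u ^ ξ * v ^ (1 - ξ) ≤ u + v := by
  have h := Real.geom_mean_le_arith_mean2_weighted hξ.1 (sub_nonneg.2 hξ.2) hu hv (by ring)
  nlinarith [mul_nonneg hu (sub_nonneg.2 hξ.2), mul_nonneg hv hξ.1]

lemma intervalIntegrable_logMean (hu : 0 ≤ u) (hv : 0 ≤ v) :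
    IntervalIntegrable (fun ξ : ℝ => u ^ ξ * v ^ (1 - ξ)) volume 0 1 := by
  rw [intervalIntegrable_iff, uIoc_of_le zero_le_one]
  refine Measure.integrableOn_of_bounded (M := u + v) (by simp) (by fun_prop) ?_
  filter_upwards [ae_restrict_mem measurableSet_Ioc] with ξ hξ
  rw [Real.norm_of_nonneg (by positivity)]
  exact rpow_mul_rpow_one_sub_le_add hu hv (Ioc_subset_Icc_self hξ)

lemma logMean_nonneg (hu : 0 ≤ u) (hv : 0 ≤ v) : 0 ≤ logMean u v :=
  intervalIntegral.integral_nonneg zero_le_one fun ξ _ => by positivity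

lemma logMean_pos (hu : 0 < u) (hv : 0 < v) : 0 < logMean u v :=
  intervalIntegral.intervalIntegral_pos_of_pos (intervalIntegrable_logMean hu.le hv.le)
    (fun ξ => by positivity) zero_lt_one

lemma logMean_le_add (hu : 0 ≤ u) (hv : 0 ≤ v) : logMean u v ≤ u + v := by
  have h := intervalIntegral.integral_mono_on zero_le_one (intervalIntegrable_logMean hu hv)
    (intervalIntegrable_const (c := u + v)) fun ξ hξ => rpow_mul_rpow_one_sub_le_add hu hv hξ
  simpa [logMean] using h

lemma logMean_mono (hu : 0 ≤ u) (hv : 0 ≤ v) (huu : u ≤ u') (hvv : v ≤ v') :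
    logMean u v ≤ logMean u' v' := by
  refine intervalIntegral.integral_mono_on zero_le_one (intervalIntegrable_logMean hu hv)
    (intervalIntegrable_logMean (hu.trans huu) (hv.trans hvv)) fun ξ hξ => ?_
  have h1 := Real.rpow_le_rpow hu huu hξ.1
  have h2 := Real.rpow_le_rpow hv hvv (sub_nonneg.2 hξ.2)
  have h3 : 0 ≤ u' ^ ξ := Real.rpow_nonneg (hu.trans huu) _
  gcongr

lemma logMean_smul {c : ℝ} (hc : 0 ≤ c) (hu : 0 ≤ u) (hv : 0 ≤ v) :
    logMean (c * u) (c * v) = c * logMean u v := by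
  unfold logMean
  rw [← intervalIntegral.integral_const_mul]
  refine intervalIntegral.integral_congr_uIoo ?_
  rintro ξ hξ
  rw [uIoo_of_le zero_le_one] at hξ
  rcases hc.eq_or_lt with rfl | hc
  · simp [Real.zero_rpow hξ.1.ne']
  · have h : c ^ ξ * c ^ (1 - ξ) = c := by
      rw [← Real.rpow_add hc]; simp
    simp only
    rw [Real.mul_rpow hc.le hu, Real.mul_rpow hc.le hv]
    calc c ^ ξ * u ^ ξ * (c ^ (1 - ξ) * v ^ (1 - ξ))
        = c ^ ξ * c ^ (1 - ξ) * (u ^ ξ * v ^ (1 - ξ)) := by ring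
      _ = _ := by rw [h]

/-- Hölder's inequality for two summands: weighted geometric means are superadditive. -/
lemma rpow_mul_rpow_superadditive (hu : 0 ≤ u) (hv : 0 ≤ v) (hu' : 0 ≤ u') (hv' : 0 ≤ v')
    {ξ : ℝ} (h0 : 0 < ξ) (h1 : ξ < 1) :
    u ^ ξ * v ^ (1 - ξ) + u' ^ ξ * v' ^ (1 - ξ) ≤ (u + u') ^ ξ * (v + v') ^ (1 - ξ) := by
  have h1' : 0 < 1 - ξ := sub_pos.2 h1
  rcases (add_nonneg hu hu').eq_or_lt with hU | hU
  · have e1 : u = 0 := by linarith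
    have e2 : u' = 0 := by linarith
    simp [e1, e2, Real.zero_rpow h0.ne']
  rcases (add_nonneg hv hv').eq_or_lt with hV | hV
  · have e1 : v = 0 := by linarith
    have e2 : v' = 0 := by linarith
    simp [e1, e2, Real.zero_rpow h1'.ne']
  -- Divide by the right-hand side and apply the weighted AM-GM inequality to each summand.
  have key := Real.geom_mean_le_arith_mean2_weighted h0.le h1'.le
    (div_nonneg hu hU.le) (div_nonneg hv hV.le) (by ring)
  have key' := Real.geom_mean_le_arith_mean2_weighted h0.le h1'.le
    (div_nonneg hu' hU.le) (div_nonneg hv' hV.le) (by ring)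
  rw [Real.div_rpow hu hU.le, Real.div_rpow hv hV.le] at key
  rw [Real.div_rpow hu' hU.le, Real.div_rpow hv' hV.le] at key'
  have e1 : u / (u + u') + u' / (u + u') = 1 := by rw [← add_div, div_self hU.ne']
  have e2 : v / (v + v') + v' / (v + v') = 1 := by rw [← add_div, div_self hV.ne']
  have hA : 0 < (u + u') ^ ξ := Real.rpow_pos_of_pos hU _
  have hB : 0 < (v + v') ^ (1 - ξ) := Real.rpow_pos_of_pos hV _
  have hsum : (u ^ ξ * v ^ (1 - ξ) + u' ^ ξ * v' ^ (1 - ξ)) /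
      ((u + u') ^ ξ * (v + v') ^ (1 - ξ)) ≤ 1 := by
    calc _ = u ^ ξ / (u + u') ^ ξ * (v ^ (1 - ξ) / (v + v') ^ (1 - ξ))
          + u' ^ ξ / (u + u') ^ ξ * (v' ^ (1 - ξ) / (v + v') ^ (1 - ξ)) := by
            field_simp
      _ ≤ ξ * (u / (u + u') + u' / (u + u')) + (1 - ξ) * (v / (v + v') + v' / (v + v')) := by
            linarith
      _ = 1 := by rw [e1, e2]; ring
  rwa [div_le_one (by positivity)] at hsum

lemma logMean_superadditive (hu : 0 ≤ u) (hv : 0 ≤ v) (hu' : 0 ≤ u') (hv' : 0 ≤ v') :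
    logMean u v + logMean u' v' ≤ logMean (u + u') (v + v') := by
  unfold logMean
  rw [← intervalIntegral.integral_add (intervalIntegrable_logMean hu hv)
    (intervalIntegrable_logMean hu' hv')]
  refine intervalIntegral.integral_mono_on_of_le_Ioo zero_le_one
    ((intervalIntegrable_logMean hu hv).add (intervalIntegrable_logMean hu' hv'))
    (intervalIntegrable_logMean (add_nonneg hu hu') (add_nonneg hv hv')) fun ξ hξ => ?_
  exact rpow_mul_rpow_superadditive hu hv hu' hv' hξ.1 hξ.2

lemma measurable_logMean : Measurable fun z : ℝ × ℝ => logMean z.1 z.2 := by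
  unfold logMean
  simp_rw [intervalIntegral.integral_of_le zero_le_one]
  have h : Measurable fun q : (ℝ × ℝ) × ℝ => q.1.1 ^ q.2 * q.1.2 ^ (1 - q.2) := by fun_prop
  exact h.stronglyMeasurable.integral_prod_right'.measurable

end LogMean

section Mobility

variable {X : Type*} {μ ν : X → ℝ}

lemma mobility_nonneg (hμ : ∀ x, 0 ≤ μ x) (x y : X) : 0 ≤ mobility μ x y :=
  logMean_nonneg (hμ x) (hμ y)

lemma mobility_pos (hμ : ∀ x, 0 < μ x) (x y : X) : 0 < mobility μ x y :=
  logMean_pos (hμ x) (hμ y)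

lemma mobility_mono (hμ : ∀ x, 0 ≤ μ x) (h : ∀ x, μ x ≤ ν x) (x y : X) :
    mobility μ x y ≤ mobility ν x y :=
  logMean_mono (hμ x) (hμ y) (h x) (h y)

lemma mobility_superadditive (hμ : ∀ x, 0 ≤ μ x) (hν : ∀ x, 0 ≤ ν x) (x y : X) :
    mobility μ x y + mobility ν x y ≤ mobility (μ + ν) x y :=
  logMean_superadditive (hμ x) (hμ y) (hν x) (hν y)

lemma mobility_smul {c : ℝ} (hc : 0 ≤ c) (hμ : ∀ x, 0 ≤ μ x) (x y : X) :
    mobility (c • μ) x y = c * mobility μ x y :=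
  logMean_smul hc (hμ x) (hμ y)

/-- The mobility is concave, being superadditive and positively homogeneous. -/
lemma mobility_concave {s t : ℝ} (hs : 0 ≤ s) (ht : 0 ≤ t) (hμ : ∀ x, 0 ≤ μ x)
    (hν : ∀ x, 0 ≤ ν x) (x y : X) :
    s * mobility μ x y + t * mobility ν x y ≤ mobility (s • μ + t • ν) x y := by
  rw [← mobility_smul hs hμ, ← mobility_smul ht hν]
  exact mobility_superadditive (fun z => mul_nonneg hs (hμ z)) (fun z => mul_nonneg ht (hν z)) x y

lemma measurable_mobility {Ω : Type*} [MeasurableSpace Ω] {μ : Ω → X → ℝ}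
    (hμ : ∀ x, Measurable fun t => μ t x) :
    Measurable fun t => mobility (μ t) :=
  measurable_pi_lambda _ fun x => measurable_pi_lambda _ fun y =>
    measurable_logMean.comp ((hμ x).prodMk (hμ y))

end Mobility

/-! ### Dirichlet energies and weighted Laplacians of the chain -/

namespace RevChain

variable {X : Type*} [Fintype X] (C : RevChain X)

lemma K_nonneg (x y : X) : 0 ≤ C.K x y := C.irreducible.nonneg x y

/-- A property that is preserved along the edges of the chain and holds somewhere holds
everywhere. -/
lemma edge_induction {P : X → Prop} (hP : ∀ x y, 0 < C.K x y → P x → P y) {x : X} (hx : P x)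
    (y : X) : P y := by
  let := C.K.toQuiver
  obtain ⟨q, -⟩ := C.irreducible.connected x y
  induction q with
  | nil => exact hx
  | cons _ e ih => exact hP _ _ e.down ih

/-- The invariant distribution has full support, by irreducibility and reversibility. -/
lemma ϖ_pos (x : X) : 0 < C.ϖ x := by
  obtain ⟨z, hz⟩ : ∃ z, 0 < C.ϖ z := by
    by_contra! h
    have : ∑ x, C.ϖ x ≤ 0 := Finset.sum_nonpos fun x _ => h x
    linarith [C.ϖ_sum]
  refine C.edge_induction (P := fun x => 0 < C.ϖ x) (fun x y hxy hx => ?_) hz x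
  have h := C.reversible x y
  have h' : 0 < C.K y x * C.ϖ y := h ▸ mul_pos hxy hx
  exact (C.ϖ_nonneg y).lt_of_ne fun h0 => by simp [← h0] at h'

lemma sum_K_mul_ϖ : ∑ x, ∑ y, C.K x y * C.ϖ x = 1 := by
  simp_rw [← Finset.sum_mul, C.row_sum, one_mul, C.ϖ_sum]

lemma pairing_comm (φ ψ : X → ℝ) : C.pairing φ ψ = C.pairing ψ φ := by
  simp [pairing, mul_comm]

lemma pairing_add_right (φ ψ ψ' : X → ℝ) :
    C.pairing φ (ψ + ψ') = C.pairing φ ψ + C.pairing φ ψ' := by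
  simp [pairing, mul_add, add_mul, Finset.sum_add_distrib]

lemma pairing_sub_right (φ ψ ψ' : X → ℝ) :
    C.pairing φ (ψ - ψ') = C.pairing φ ψ - C.pairing φ ψ' := by
  simp [pairing, mul_sub, sub_mul, Finset.sum_sub_distrib]

lemma pairing_smul_right (c : ℝ) (φ ψ : X → ℝ) :
    C.pairing φ (c • ψ) = c * C.pairing φ ψ := by
  simp only [pairing, Finset.mul_sum, Pi.smul_apply, smul_eq_mul]
  exact Finset.sum_congr rfl fun x _ => by ring

lemma pairing_add_left (φ φ' ψ : X → ℝ) :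
    C.pairing (φ + φ') ψ = C.pairing φ ψ + C.pairing φ' ψ := by
  simp_rw [C.pairing_comm _ ψ, pairing_add_right]

lemma pairing_sub_left (φ φ' ψ : X → ℝ) :
    C.pairing (φ - φ') ψ = C.pairing φ ψ - C.pairing φ' ψ := by
  simp_rw [C.pairing_comm _ ψ, pairing_sub_right]

lemma pairing_smul_left (c : ℝ) (φ ψ : X → ℝ) :
    C.pairing (c • φ) ψ = c * C.pairing φ ψ := by
  simp_rw [C.pairing_comm _ ψ, pairing_smul_right]

lemma pairing_single [DecidableEq X] (x : X) (ψ : X → ℝ) :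
    C.pairing (Pi.single x 1) ψ = ψ x * C.ϖ x := by
  simp [pairing, Pi.single_apply]

lemma pairing_one_eq_one {p : X → ℝ} (hp : p ∈ posDensities X) (hp1 : C.l1Norm p = 1) :
    C.pairing 1 p = 1 := by
  rw [← hp1]
  exact Finset.sum_congr rfl fun x _ => by rw [abs_of_pos (hp x)]; simp [mul_comm]

lemma pairing_ext {ψ ψ' : X → ℝ} (h : ∀ φ, C.pairing φ ψ = C.pairing φ ψ') : ψ = ψ' := by
  classical
  funext x
  have := h (Pi.single x 1)
  rw [pairing_single, pairing_single] at this
  exact mul_right_cancel₀ (C.ϖ_pos x).ne' this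

/-- The Dirichlet form `½ ∑ ∇φ(x,y) ∇η(x,y) w(x,y) K(x,y) ϖ(x)` with edge weights `w`. -/
def energy (w : X → X → ℝ) (φ η : X → ℝ) : ℝ :=
  1 / 2 * ∑ x, ∑ y, grad φ x y * grad η x y * w x y * C.K x y * C.ϖ x

/-- The weighted Laplacian `ψ ↦ div (w ∇ψ)` with edge weights `w`. -/
def flow (w : X → X → ℝ) (ψ : X → ℝ) : X → ℝ :=
  C.divergence fun y z => w y z * grad ψ y z

lemma energy_comm (w : X → X → ℝ) (φ η : X → ℝ) : C.energy w φ η = C.energy w η φ := by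
  simp only [energy, mul_comm (grad φ _ _)]

lemma energy_add_right (w : X → X → ℝ) (φ η η' : X → ℝ) :
    C.energy w φ (η + η') = C.energy w φ η + C.energy w φ η' := by
  simp only [energy, grad, ← mul_add, ← Finset.sum_add_distrib, Pi.add_apply]
  congr! 3
  ring

lemma energy_smul_right (w : X → X → ℝ) (c : ℝ) (φ η : X → ℝ) :
    C.energy w φ (c • η) = c * C.energy w φ η := by
  simp only [energy, grad, Finset.mul_sum, Pi.smul_apply, smul_eq_mul]
  congr! 2
  ring

lemma energy_add_left (w : X → X → ℝ) (φ φ' η : X → ℝ) :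
    C.energy w (φ + φ') η = C.energy w φ η + C.energy w φ' η := by
  simp_rw [C.energy_comm w _ η, energy_add_right]

lemma energy_smul_left (w : X → X → ℝ) (c : ℝ) (φ η : X → ℝ) :
    C.energy w (c • φ) η = c * C.energy w φ η := by
  simp_rw [C.energy_comm w _ η, energy_smul_right]

lemma energy_sub_right (w : X → X → ℝ) (φ η η' : X → ℝ) :
    C.energy w φ (η - η') = C.energy w φ η - C.energy w φ η' := by
  have h := C.energy_add_right w φ (η - η') η'
  rw [sub_add_cancel] at h
  linarith

lemma energy_sub_left (w : X → X → ℝ) (φ φ' η : X → ℝ) :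
    C.energy w (φ - φ') η = C.energy w φ η - C.energy w φ' η := by
  simp_rw [C.energy_comm w _ η, energy_sub_right]

lemma energy_weight_add (w w' : X → X → ℝ) (φ η : X → ℝ) :
    C.energy (w + w') φ η = C.energy w φ η + C.energy w' φ η := by
  simp only [energy, ← mul_add, ← Finset.sum_add_distrib, Pi.add_apply]
  congr! 3
  ring

lemma energy_weight_smul (c : ℝ) (w : X → X → ℝ) (φ η : X → ℝ) :
    C.energy (c • w) φ η = c * C.energy w φ η := by
  simp only [energy, Finset.mul_sum, Pi.smul_apply, smul_eq_mul]
  congr! 2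
  ring

lemma energy_mono {w w' : X → X → ℝ} (h : ∀ x y, w x y ≤ w' x y) (φ : X → ℝ) :
    C.energy w φ φ ≤ C.energy w' φ φ := by
  unfold energy
  gcongr with x _ y _
  · exact C.ϖ_nonneg x
  · exact C.K_nonneg x y
  · exact mul_self_nonneg _
  · exact h x y

lemma energy_nonneg {w : X → X → ℝ} (hw : ∀ x y, 0 ≤ w x y) (φ : X → ℝ) :
    0 ≤ C.energy w φ φ := by
  have h := C.energy_mono hw φ
  have h0 : C.energy (fun _ _ => 0) φ φ = 0 := by simp [energy]
  linarith

lemma normMu_sq {μ : X → ℝ} (hμ : ∀ x, 0 ≤ μ x) (φ : X → ℝ) :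
    C.normMu μ (grad φ) ^ 2 = C.energy (mobility μ) φ φ :=
  Real.sq_sqrt (C.energy_nonneg (mobility_nonneg hμ) φ)

/-- Young's inequality for the Dirichlet form. -/
lemma two_mul_energy_le {w : X → X → ℝ} (hw : ∀ x y, 0 ≤ w x y) (φ η : X → ℝ) :
    2 * C.energy w φ η ≤ C.energy w φ φ + C.energy w η η := by
  have h := C.energy_nonneg hw (φ - η)
  rw [energy_sub_left, energy_sub_right, energy_sub_right, C.energy_comm w η φ] at h
  linarith

/-- The Cauchy–Schwarz inequality for the Dirichlet form. -/
lemma energy_sq_le {w : X → X → ℝ} (hw : ∀ x y, 0 ≤ w x y) (φ η : X → ℝ) :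
    C.energy w φ η ^ 2 ≤ C.energy w φ φ * C.energy w η η := by
  have h : ∀ t : ℝ, 0 ≤ C.energy w φ φ * (t * t) + 2 * C.energy w φ η * t + C.energy w η η := by
    intro t
    have h := C.energy_nonneg hw (t • φ + η)
    simp only [energy_add_left, energy_add_right, energy_smul_left, energy_smul_right,
      C.energy_comm w η φ] at h
    linarith
  have := discrim_le_zero h
  rw [discrim] at this
  nlinarith

lemma energy_convex {w : X → X → ℝ} (hw : ∀ x y, 0 ≤ w x y) (φ η : X → ℝ) {s t : ℝ}
    (hs : 0 ≤ s) (ht : 0 ≤ t) (hst : s + t = 1) :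
    C.energy w (s • φ + t • η) (s • φ + t • η) ≤ s * C.energy w φ φ + t * C.energy w η η := by
  have h := mul_le_mul_of_nonneg_left (C.two_mul_energy_le hw φ η) (mul_nonneg hs ht)
  simp only [energy_add_left, energy_add_right, energy_smul_left, energy_smul_right,
    C.energy_comm w η φ]
  obtain rfl : t = 1 - s := by linarith
  nlinarith

/-- Integration by parts, which rests on reversibility. -/
lemma pairing_divergence (η : X → ℝ) (Ψ : X → X → ℝ) :
    C.pairing η (C.divergence Ψ)
      = -(1 / 2 * ∑ x, ∑ y, grad η x y * Ψ x y * C.K x y * C.ϖ x) := by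
  have h1 : C.pairing η (C.divergence Ψ) = 1 / 2 * (∑ x, ∑ y, η x * Ψ x y * C.K x y * C.ϖ x
      - ∑ x, ∑ y, η x * Ψ y x * C.K x y * C.ϖ x) := by
    simp only [pairing, divergence, ← Finset.sum_sub_distrib, Finset.mul_sum, Finset.sum_mul]
    congr! 2
    ring
  have h2 : ∑ x, ∑ y, η x * Ψ y x * C.K x y * C.ϖ x
      = ∑ x, ∑ y, η y * Ψ x y * C.K x y * C.ϖ x := by
    rw [Finset.sum_comm]
    refine Finset.sum_congr rfl fun x _ => Finset.sum_congr rfl fun y _ => ?_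
    rw [mul_assoc _ (C.K y x), C.reversible y x, ← mul_assoc]
  rw [h1, h2, ← mul_neg, ← Finset.sum_sub_distrib, ← Finset.sum_neg_distrib]
  congr 1
  refine Finset.sum_congr rfl fun x _ => ?_
  rw [← Finset.sum_sub_distrib, ← Finset.sum_neg_distrib]
  refine Finset.sum_congr rfl fun y _ => ?_
  simp only [grad]
  ring

lemma pairing_flow (w : X → X → ℝ) (η ψ : X → ℝ) :
    C.pairing η (C.flow w ψ) = -C.energy w ψ η := by
  rw [flow, pairing_divergence, energy]
  congr! 6
  ring

lemma flow_smul (w : X → X → ℝ) (c : ℝ) (ψ : X → ℝ) : C.flow w (c • ψ) = c • C.flow w ψ := by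
  refine C.pairing_ext fun η => ?_
  rw [pairing_flow, pairing_smul_right, pairing_flow, energy_smul_left, mul_neg]

lemma flow_add (w : X → X → ℝ) (ψ ψ' : X → ℝ) :
    C.flow w (ψ + ψ') = C.flow w ψ + C.flow w ψ' := by
  refine C.pairing_ext fun η => ?_
  rw [pairing_flow, pairing_add_right, pairing_flow, pairing_flow, energy_add_left]
  ring

lemma pairing_one_flow (w : X → X → ℝ) (ψ : X → ℝ) : C.pairing 1 (C.flow w ψ) = 0 := by
  rw [pairing_flow]
  simp [energy, grad]

/-- By irreducibility, only the constants have zero energy for positive weights. -/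
lemma eq_of_energy_eq_zero {w : X → X → ℝ} (hw : ∀ x y, 0 < w x y) {φ : X → ℝ}
    (h : C.energy w φ φ = 0) (x y : X) : φ x = φ y := by
  have hterm : ∀ x y, 0 ≤ grad φ x y * grad φ x y * w x y * C.K x y * C.ϖ x := fun x y =>
    mul_nonneg (mul_nonneg (mul_nonneg (mul_self_nonneg _) (hw x y).le) (C.K_nonneg x y))
      (C.ϖ_nonneg x)
  have h0 : ∑ x, ∑ y, grad φ x y * grad φ x y * w x y * C.K x y * C.ϖ x = 0 := by
    unfold energy at h; linarith
  rw [Finset.sum_eq_zero_iff_of_nonneg fun x _ => Finset.sum_nonneg fun y _ => hterm x y] at h0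
  have hedge : ∀ x y, 0 < C.K x y → φ y = φ x := by
    intro x y hxy
    have h1 := h0 x (Finset.mem_univ x)
    rw [Finset.sum_eq_zero_iff_of_nonneg fun y _ => hterm x y] at h1
    have h2 := h1 y (Finset.mem_univ y)
    simpa [grad, (hw x y).ne', hxy.ne', (C.ϖ_pos x).ne', sub_eq_zero] using h2
  exact (C.edge_induction (P := fun z => φ z = φ x) (fun a b hab ha => (hedge a b hab).trans ha)
    rfl y).symm

lemma eq_zero_of_energy_eq_zero {w : X → X → ℝ} (hw : ∀ x y, 0 < w x y) {φ q : X → ℝ}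
    (hq : C.pairing 1 q ≠ 0) (h : C.energy w φ φ = 0) (hφ : C.pairing φ q = 0) : φ = 0 := by
  funext x
  have hc : φ = φ x • (1 : X → ℝ) := funext fun y => by
    simp [C.eq_of_energy_eq_zero hw h y x]
  rw [hc, pairing_smul_left] at hφ
  simpa [hq] using hφ

/-- The value of a weighted Laplacian at a point, bounded by the energy. -/
lemma flow_apply_sq_le {w : X → X → ℝ} (hw : ∀ x y, 0 ≤ w x y) {W : ℝ}
    (hW : ∀ x y, w x y ≤ W) (ψ : X → ℝ) (x : X) :
    (C.flow w ψ x * C.ϖ x) ^ 2 ≤ C.energy w ψ ψ * W := by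
  classical
  -- Test the weighted Laplacian with the indicator of `x`.
  rw [← pairing_single, pairing_flow, neg_sq]
  refine (C.energy_sq_le hw _ _).trans ?_
  refine mul_le_mul_of_nonneg_left ?_ (C.energy_nonneg hw ψ)
  have hW0 : 0 ≤ W := (hw x x).trans (hW x x)
  have hle : ∀ y z : X, grad (Pi.single x 1 : X → ℝ) y z * grad (Pi.single x 1 : X → ℝ) y z
      * w y z * C.K y z * C.ϖ y ≤ W * (C.K y z * C.ϖ y) := by
    intro y z
    have hg : grad (Pi.single x 1 : X → ℝ) y z * grad (Pi.single x 1 : X → ℝ) y z ≤ 1 := by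
      simp only [grad, Pi.single_apply]
      split_ifs <;> norm_num
    have hg0 := mul_self_nonneg (grad (Pi.single x 1 : X → ℝ) y z)
    have hgw : grad (Pi.single x 1 : X → ℝ) y z * grad (Pi.single x 1 : X → ℝ) y z
        * w y z ≤ W := by
      nlinarith [hw y z, hW y z]
    rw [mul_assoc _ (C.K y z)]
    exact mul_le_mul_of_nonneg_right hgw (mul_nonneg (C.K_nonneg y z) (C.ϖ_nonneg y))
  have hs : ∑ y, ∑ z, grad (Pi.single x 1 : X → ℝ) y z * grad (Pi.single x 1 : X → ℝ) y z
      * w y z * C.K y z * C.ϖ y ≤ W := by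
    calc _ ≤ ∑ y, ∑ z, W * (C.K y z * C.ϖ y) :=
          Finset.sum_le_sum fun y _ => Finset.sum_le_sum fun z _ => hle y z
      _ = W := by simp_rw [← Finset.mul_sum, C.sum_K_mul_ϖ, mul_one]
  unfold energy
  linarith

end RevChain

/-! ### A minimax principle and quadratic maximisation in finite dimension -/

section Minimax

variable {E F : Type*} [NormedAddCommGroup E] [NormedSpace ℝ E] [AddCommGroup F] [Module ℝ F]

/-- The minimax principle for finitely many convex functionals: if at every point one of the
concave functions `K i` is less than `c`, then some convex combination of them is at most `c`
everywhere. The weights come from separating the hypograph of `(K i)ᵢ` from an orthant. -/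
lemma exists_weights_of_forall_exists_lt {ι : Type*} [Fintype ι] {K : ι → E → ℝ} {c : ℝ}
    (hK : ∀ i, ConcaveOn ℝ univ (K i)) (h : ∀ φ, ∃ i, K i φ < c) :
    ∃ l : ι → ℝ, (∀ i, 0 ≤ l i) ∧ ∑ i, l i = 1 ∧ ∀ φ, ∑ i, l i * K i φ ≤ c := by
  classical
  let A : Set (ι → ℝ) := {z | ∃ φ, ∀ i, z i ≤ K i φ}
  let B : Set (ι → ℝ) := {z | ∀ i, c < z i}
  have hA : Convex ℝ A := by
    rintro z ⟨φ, hφ⟩ z' ⟨φ', hφ'⟩ s t hs ht hst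
    refine ⟨s • φ + t • φ', fun i => ?_⟩
    refine le_trans ?_ ((hK i).2 (mem_univ φ) (mem_univ φ') hs ht hst)
    simp only [Pi.add_apply, Pi.smul_apply, smul_eq_mul]
    have h1 := mul_le_mul_of_nonneg_left (hφ i) hs
    have h2 := mul_le_mul_of_nonneg_left (hφ' i) ht
    linarith
  have hBpi : B = Set.pi univ fun _ => Ioi c := by
    ext z; simp [B]
  have hB : Convex ℝ B := hBpi ▸ convex_pi fun _ _ => convex_Ioi c
  have hBo : IsOpen B := hBpi ▸ isOpen_set_pi finite_univ fun _ _ => isOpen_Ioi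
  have hdisj : Disjoint B A := by
    rw [Set.disjoint_left]
    rintro z hz ⟨φ, hφ⟩
    obtain ⟨i, hi⟩ := h φ
    exact absurd (hz i) (not_lt.2 ((hφ i).trans hi.le))
  obtain ⟨f, u, hfB, hfA⟩ := geometric_hahn_banach_open hB hBo hA hdisj
  -- `f z = -∑ lᵢ zᵢ` with weights `lᵢ ≥ 0`, because `A` is unbounded below in each direction.
  set l : ι → ℝ := fun i => -f (Pi.single i 1) with hl
  have hf : ∀ z : ι → ℝ, f z = -∑ i, l i * z i := by
    intro z
    conv_lhs => rw [← Finset.univ_sum_single z]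
    rw [map_sum, ← Finset.sum_neg_distrib]
    refine Finset.sum_congr rfl fun i _ => ?_
    have : (Pi.single i (z i) : ι → ℝ) = z i • Pi.single i 1 := by
      rw [← Pi.single_smul]; simp
    rw [this, map_smul, hl]
    simp [mul_comm]
  have hKA : ∀ φ, (fun i => K i φ) ∈ A := fun φ => ⟨φ, fun i => le_rfl⟩
  have hl0 : ∀ i, 0 ≤ l i := by
    intro i
    by_contra! hi
    have hz : ∀ r : ℝ, 0 ≤ r → u ≤ f (fun j => K j 0) + r * l i := by
      intro r hr
      have hmem : ((fun j => K j 0) - r • Pi.single i 1 : ι → ℝ) ∈ A := by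
        refine ⟨0, fun j => ?_⟩
        have : 0 ≤ r * (Pi.single i 1 : ι → ℝ) j := by
          refine mul_nonneg hr ?_
          rw [Pi.single_apply]; split_ifs <;> norm_num
        simp only [Pi.sub_apply, Pi.smul_apply, smul_eq_mul]
        linarith
      have := hfA _ hmem
      rw [map_sub, map_smul, smul_eq_mul] at this
      rw [hl]; linarith
    have h1 := hz ((|f (fun j => K j 0) - u| + 1) / (-l i))
      (div_nonneg (by positivity) (by linarith))
    have h2 : (|f (fun j => K j 0) - u| + 1) / (-l i) * l i = -(|f (fun j => K j 0) - u| + 1) := by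
      have := hi.ne; field_simp
    have h3 := le_abs_self (f (fun j => K j 0) - u)
    rw [h2] at h1
    linarith
  -- Points of `B` close to the corner `(c, …, c)` determine the separating level.
  have hBmem : ∀ r : ℝ, 0 < r → -((c + r) * ∑ i, l i) < u := by
    intro r hr
    have := hfB (fun _ => c + r) fun i => by linarith
    rw [hf, ← Finset.sum_mul] at this
    linarith
  have hlsum : 0 < ∑ i, l i := by
    refine (Finset.sum_nonneg fun i _ => hl0 i).lt_of_ne fun h0 => ?_
    have hli : ∀ i, l i = 0 := fun i =>
      (Finset.sum_eq_zero_iff_of_nonneg fun i _ => hl0 i).1 h0.symm i (Finset.mem_univ i)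
    have h1 := hBmem 1 one_pos
    have h2 := hfA _ (hKA 0)
    rw [hf] at h2
    simp [hli] at h1 h2
    linarith
  refine ⟨fun i => l i / ∑ j, l j, fun i => div_nonneg (hl0 i) hlsum.le, ?_, fun φ => ?_⟩
  · rw [← Finset.sum_div, div_self hlsum.ne']
  · have h1 := hfA _ (hKA φ)
    rw [hf] at h1
    have h2 : ∑ i, l i * K i φ ≤ c * ∑ i, l i := by
      refine le_of_forall_pos_le_add fun r hr => ?_
      have := hBmem (r / ∑ i, l i) (div_pos hr hlsum)
      rw [add_mul, div_mul_cancel₀ _ hlsum.ne'] at this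
      linarith
    have h3 : ∑ i, l i / (∑ j, l j) * K i φ = (∑ i, l i * K i φ) / ∑ j, l j := by
      rw [Finset.sum_div]
      exact Finset.sum_congr rfl fun i _ => by ring
    rw [h3, div_le_iff₀ hlsum]
    exact h2

/-- A minimax principle: `K φ y` is concave in `φ` and convex in `y`, and compactness is only
needed for one superlevel set in `φ`. -/
lemma exists_forall_le_of_forall_exists_lt {Y : Set F} (hY : Convex ℝ Y) {K : E → F → ℝ} {c : ℝ}
    (hconc : ∀ y ∈ Y, ConcaveOn ℝ univ fun φ => K φ y)
    (hcont : ∀ y ∈ Y, Continuous fun φ => K φ y)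
    (hconv : ∀ φ, ConvexOn ℝ Y (K φ)) {y₀ : F} (hy₀ : y₀ ∈ Y)
    (hcomp : IsCompact {φ | c ≤ K φ y₀}) (h : ∀ φ, ∃ y ∈ Y, K φ y < c) :
    ∃ y ∈ Y, ∀ φ, K φ y ≤ c := by
  classical
  -- Finitely many `y` suffice on the compact set, and `y₀` takes care of its complement.
  obtain ⟨t, ht⟩ := hcomp.elim_finite_subcover (fun y : Y => {φ | K φ y < c})
    (fun y => isOpen_lt (hcont y y.2) continuous_const) fun φ _ => by
      obtain ⟨y, hy, hyc⟩ := h φ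
      exact mem_iUnion.2 ⟨⟨y, hy⟩, hyc⟩
  let s : Finset Y := insert ⟨y₀, hy₀⟩ t
  obtain ⟨l, hl0, hl1, hl⟩ := exists_weights_of_forall_exists_lt (c := c)
    (K := fun (y : s) φ => K φ (y : Y)) (fun y => hconc _ y.1.2) fun φ => by
      by_cases hφ : c ≤ K φ y₀
      · obtain ⟨y, hy, hyc⟩ := mem_iUnion₂.1 (ht hφ)
        exact ⟨⟨y, Finset.mem_insert_of_mem hy⟩, hyc⟩
      · exact ⟨⟨⟨y₀, hy₀⟩, Finset.mem_insert_self _ _⟩, not_le.1 hφ⟩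
  -- By convexity in `y`, the barycentre of the finitely many points is as good as the mixture.
  refine ⟨∑ y : s, l y • ((y : Y) : F), hY.sum_mem (fun y _ => hl0 y) hl1 fun y _ => y.1.2,
    fun φ => ?_⟩
  refine le_trans ?_ (hl φ)
  simpa using (hconv φ).map_sum_le (t := Finset.univ) (w := l) (p := fun y : s => ((y : Y) : F))
    (fun y _ => hl0 y) hl1 fun y _ => y.1.2

/-- A functional `ℓ - ½ B` with `B` symmetric and positive semidefinite is concave. -/
lemma concaveOn_sub_quadratic (B : E →ₗ[ℝ] E →ₗ[ℝ] ℝ) (hsymm : ∀ φ η, B φ η = B η φ) (hB : ∀ φ, 0 ≤ B φ φ)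
    (ℓ : E →ₗ[ℝ] ℝ) : ConcaveOn ℝ univ fun φ => ℓ φ - 1 / 2 * B φ φ := by
  refine ⟨convex_univ, fun φ _ η _ s t hs ht hst => ?_⟩
  have h := hB (φ - η)
  simp only [map_sub, map_add, map_smul, LinearMap.sub_apply, LinearMap.add_apply,
    LinearMap.smul_apply, smul_eq_mul, hsymm η φ] at h ⊢
  obtain rfl : t = 1 - s := by linarith
  nlinarith [mul_nonneg (mul_nonneg hs ht) h]

variable [FiniteDimensional ℝ E]

lemma continuous_linearMap_diag (B : E →ₗ[ℝ] E →ₗ[ℝ] ℝ) : Continuous fun φ => B φ φ := by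
  have h1 : Continuous fun φ => LinearMap.toContinuousLinearMap (B φ) :=
    ((LinearMap.toContinuousLinearMap (𝕜 := ℝ) (E := E) (F' := ℝ)).toLinearMap
      ∘ₗ B).continuous_of_finiteDimensional
  exact h1.clm_apply continuous_id

/-- A positive definite quadratic form on a finite-dimensional space makes the superlevel sets of
`ℓ - ½ B` compact. -/
lemma isCompact_superlevel_quadratic (B : E →ₗ[ℝ] E →ₗ[ℝ] ℝ) (hB : ∀ φ, φ ≠ 0 → 0 < B φ φ)
    (ℓ : E →ₗ[ℝ] ℝ) (c : ℝ) : IsCompact {φ | c ≤ ℓ φ - 1 / 2 * B φ φ} := by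
  have hBc := continuous_linearMap_diag B
  have hℓc : Continuous ℓ := ℓ.continuous_of_finiteDimensional
  have hcont : Continuous fun φ => ℓ φ - 1 / 2 * B φ φ := hℓc.sub (continuous_const.mul hBc)
  obtain ⟨m, hm, hmB⟩ : ∃ m > 0, ∀ φ : E, ‖φ‖ = 1 → m ≤ B φ φ := by
    have hS : IsCompact (Metric.sphere (0 : E) 1) := isCompact_sphere 0 1
    rcases (Metric.sphere (0 : E) 1).eq_empty_or_nonempty with he | hne
    · exact ⟨1, one_pos, fun φ hφ => absurd (mem_sphere_zero_iff_norm.2 hφ) (by simp [he])⟩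
    · obtain ⟨φ₀, hφ₀, hmin⟩ := hS.exists_isMinOn hne hBc.continuousOn
      refine ⟨B φ₀ φ₀, hB φ₀ ?_, fun φ hφ => hmin (mem_sphere_zero_iff_norm.2 hφ)⟩
      rintro rfl
      simp at hφ₀
  obtain ⟨L, hL0, hL⟩ : ∃ L : ℝ, 0 ≤ L ∧ ∀ φ, ℓ φ ≤ L * ‖φ‖ :=
    ⟨‖LinearMap.toContinuousLinearMap ℓ‖, norm_nonneg _, fun φ =>
      (le_abs_self _).trans ((LinearMap.toContinuousLinearMap ℓ).le_opNorm φ)⟩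
  -- Homogeneity extends the bound from the unit sphere, and the quadratic part dominates `ℓ`.
  have hquad : ∀ φ : E, m * ‖φ‖ ^ 2 ≤ B φ φ := by
    intro φ
    rcases eq_or_ne φ 0 with rfl | hφ
    · simp
    have hn : ‖φ‖ ≠ 0 := norm_ne_zero_iff.2 hφ
    have h := hmB (‖φ‖⁻¹ • φ) (by rw [norm_smul, norm_inv, norm_norm, inv_mul_cancel₀ hn])
    simp only [map_smul, LinearMap.smul_apply, smul_eq_mul] at h
    have hpos : 0 < ‖φ‖ ^ 2 := by positivity
    calc m * ‖φ‖ ^ 2 ≤ ‖φ‖⁻¹ * (‖φ‖⁻¹ * B φ φ) * ‖φ‖ ^ 2 := by gcongr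
      _ = B φ φ := by field_simp
  refine Metric.isCompact_of_isClosed_isBounded (isClosed_le continuous_const hcont) ?_
  refine (Metric.isBounded_closedBall (x := (0 : E)) (r := 2 * (L + |c| + 1) / m + 1)).subset ?_
  intro φ hφ
  rw [mem_closedBall_zero_iff]
  by_contra! hlt
  have h1 : c ≤ L * ‖φ‖ - 1 / 2 * (m * ‖φ‖ ^ 2) := by
    have : c ≤ ℓ φ - 1 / 2 * B φ φ := hφ
    linarith [hL φ, hquad φ]
  have h2 : 2 * (L + |c| + 1) < m * ‖φ‖ := by
    have : 2 * (L + |c| + 1) / m < ‖φ‖ := by linarith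
    rw [div_lt_iff₀ hm] at this
    linarith
  have h3 : 1 ≤ ‖φ‖ := by
    have : 0 ≤ 2 * (L + |c| + 1) / m := by positivity
    linarith
  nlinarith [neg_abs_le c, abs_nonneg c]

/-- A positive definite quadratic functional `ℓ - ½ B` has a stationary point, whose value
`½ B φ φ` inherits any upper bound. -/
lemma exists_stationary_quadratic (B : E →ₗ[ℝ] E →ₗ[ℝ] ℝ) (hB : ∀ φ, φ ≠ 0 → 0 < B φ φ)
    (ℓ : E →ₗ[ℝ] ℝ) {c : ℝ} (hc : ∀ φ, ℓ φ - 1 / 2 * B φ φ ≤ c) :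
    ∃ φ, (∀ η, ℓ η = B φ η) ∧ B φ φ ≤ 2 * c := by
  have hinj : Function.Injective B := by
    rw [← LinearMap.ker_eq_bot, LinearMap.ker_eq_bot']
    intro φ hφ
    by_contra h
    have := hB φ h
    simp [hφ] at this
  have hsurj : Function.Surjective B :=
    (LinearMap.injective_iff_surjective_of_finrank_eq_finrank
      (Subspace.dual_finrank_eq (K := ℝ) (V := E)).symm).1 hinj
  obtain ⟨φ, hφ⟩ := hsurj ℓ
  refine ⟨φ, fun η => by rw [hφ], ?_⟩
  have := hc φ
  rw [← hφ] at this
  linarith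

end Minimax

namespace RevChain

variable {X : Type*} [Fintype X] (C : RevChain X)

/-! ### Solving the weighted Poisson equation -/

/-- The weighted Laplacian made invertible by subtracting the mean: `ψ ↦ div (w ∇ψ) - ⟨1,ψ⟩ 1`. -/
def poissonMap (w : X → X → ℝ) : (X → ℝ) →ₗ[ℝ] X → ℝ where
  toFun ψ := C.flow w ψ - C.pairing 1 ψ • 1
  map_add' ψ ψ' := by rw [flow_add, pairing_add_right, add_smul]; abel
  map_smul' c ψ := by
    rw [flow_smul, pairing_smul_right, RingHom.id_apply, smul_sub, mul_smul]

open Classical in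
/-- The solution `ψ` of `div (w ∇ψ) = F` by Cramer's rule, which depends measurably on `w`. -/
def poissonSol (w : X → X → ℝ) (F : X → ℝ) : X → ℝ :=
  (LinearMap.toMatrix' (C.poissonMap w)).det⁻¹ •
    (LinearMap.toMatrix' (C.poissonMap w)).adjugate.mulVec F

lemma flow_poissonSol {w : X → X → ℝ} (hw : ∀ x y, 0 < w x y) {F : X → ℝ}
    (hF : C.pairing 1 F = 0) : C.flow w (C.poissonSol w F) = F := by
  classical
  have h11 : C.pairing 1 1 = 1 := by simp [pairing, C.ϖ_sum]
  -- Testing `poissonMap ψ = 0` with `ψ` makes both the energy and the mean of `ψ` vanish.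
  have hinj : Function.Injective (C.poissonMap w) := by
    rw [← LinearMap.ker_eq_bot, LinearMap.ker_eq_bot']
    intro ψ hψ
    have h := congrArg (C.pairing ψ) hψ
    change C.pairing ψ (C.flow w ψ - C.pairing 1 ψ • 1) = C.pairing ψ 0 at h
    rw [pairing_sub_right, pairing_flow, pairing_smul_right, C.pairing_comm ψ 1] at h
    have h0 : C.pairing ψ 0 = 0 := by simp [pairing]
    have he := C.energy_nonneg (fun x y => (hw x y).le) ψ
    have hs := mul_self_nonneg (C.pairing 1 ψ)
    refine C.eq_zero_of_energy_eq_zero hw (q := 1) (by rw [h11]; exact one_ne_zero)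
      (by linarith) ?_
    rw [C.pairing_comm]
    exact mul_self_eq_zero.1 (by linarith)
  set A := LinearMap.toMatrix' (C.poissonMap w) with hA
  have hdet : A.det ≠ 0 := by
    rw [hA, LinearMap.det_toMatrix']
    have hu : IsUnit (C.poissonMap w) :=
      (LinearMap.isUnit_iff_ker_eq_bot _).2 (LinearMap.ker_eq_bot.2 hinj)
    exact ((LinearMap.isUnit_iff_isUnit_det _).1 hu).ne_zero
  have hsol : C.poissonMap w (C.poissonSol w F) = F := by
    rw [← LinearMap.toMatrix'_mulVec (C.poissonMap w)]
    change A.mulVec (A.det⁻¹ • A.adjugate.mulVec F) = F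
    rw [Matrix.mulVec_smul, Matrix.mulVec_mulVec, Matrix.mul_adjugate, Matrix.smul_mulVec,
      Matrix.one_mulVec, smul_smul, inv_mul_cancel₀ hdet, one_smul]
  -- Testing with the constant `1` shows that the solution has mean zero.
  have hmean : C.pairing 1 (C.poissonSol w F) = 0 := by
    have h := congrArg (C.pairing 1) hsol
    change C.pairing 1 (C.flow w _ - C.pairing 1 _ • 1) = C.pairing 1 F at h
    rw [pairing_sub_right, pairing_one_flow, pairing_smul_right, h11, hF] at h
    linarith
  have h : C.flow w (C.poissonSol w F) - C.pairing 1 (C.poissonSol w F) • 1 = F := hsol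
  rwa [hmean, zero_smul, sub_zero] at h

lemma measurable_poissonSol (F : X → ℝ) : Measurable fun w => C.poissonSol w F := by
  classical
  have hA : Continuous fun w : X → X → ℝ => LinearMap.toMatrix' (C.poissonMap w) := by
    refine continuous_matrix fun x y => ?_
    simp only [LinearMap.toMatrix'_apply, poissonMap, LinearMap.coe_mk, AddHom.coe_mk, flow,
      divergence, Pi.sub_apply, grad]
    fun_prop
  refine Measurable.smul (hA.matrix_det.measurable.inv) ?_
  exact (hA.matrix_adjugate.matrix_mulVec continuous_const).measurable

/-! ### Concatenation of admissible curves -/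

/-- `C.Joins a b p T α β A`: a solution of the continuity equation on `[0,T]`, given as the
primitive `α + ∫₀ᵗ g` of its velocity `g`, leads from `α` to `β` with action at most `A`. Unlike
an admissible triple it satisfies the equation at every time for the given `g`, which spares the
derivative of the curve when curves are concatenated. -/
def Joins (a b : ℝ) (p : X → ℝ) (T : ℝ) (α β : X → ℝ) (A : ℝ) : Prop :=
  ∃ (g ψ : ℝ → X → ℝ) (h : ℝ → ℝ), Measurable ψ ∧ Measurable h ∧
    (∀ x, IntervalIntegrable (fun t => g t x) volume 0 T) ∧
    (∀ x, α x + ∫ s in (0 : ℝ)..T, g s x = β x) ∧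
    (∀ t ∈ Icc 0 T, ∀ x, 0 ≤ α x + ∫ s in (0 : ℝ)..t, g s x) ∧
    (∀ t ∈ Icc 0 T, ∀ x,
      g t x + C.flow (mobility fun x => α x + ∫ s in (0 : ℝ)..t, g s x) (ψ t) x = h t * p x) ∧
    ∫⁻ t in Icc 0 T, ENNReal.ofReal (a ^ 2 * h t ^ 2 + b ^ 2 *
      C.energy (mobility fun x => α x + ∫ s in (0 : ℝ)..t, g s x) (ψ t) (ψ t)) ≤ ENNReal.ofReal A

variable {C} {a b : ℝ} {p : X → ℝ}

/-- Concatenation: run through the second curve after the first one. -/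
lemma Joins.trans {T₁ T₂ A₁ A₂ : ℝ} {α β γ : X → ℝ} (hT₁ : 0 ≤ T₁) (hT₂ : 0 ≤ T₂) (hA₁ : 0 ≤ A₁)
    (hA₂ : 0 ≤ A₂) (H₁ : C.Joins a b p T₁ α β A₁) (H₂ : C.Joins a b p T₂ β γ A₂) :
    C.Joins a b p (T₁ + T₂) α γ (A₁ + A₂) := by
  obtain ⟨g₁, ψ₁, h₁, hψ₁, hh₁, hg₁, hβ, hnn₁, hce₁, hact₁⟩ := H₁
  obtain ⟨g₂, ψ₂, h₂, hψ₂, hh₂, hg₂, hγ, hnn₂, hce₂, hact₂⟩ := H₂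
  set g : ℝ → X → ℝ := fun t => if t ≤ T₁ then g₁ t else g₂ (t - T₁) with hg
  set ψ : ℝ → X → ℝ := fun t => if t ≤ T₁ then ψ₁ t else ψ₂ (t - T₁) with hψ
  set h : ℝ → ℝ := fun t => if t ≤ T₁ then h₁ t else h₂ (t - T₁) with hh
  have hgI₁ : ∀ t ∈ Icc 0 T₁, ∀ x, EqOn (fun s => g₁ s x) (fun s => g s x) (uIoc 0 t) := by
    intro t ht x s hs
    rw [uIoc_of_le ht.1] at hs
    simp [hg, hs.2.trans ht.2]
  have hgI₂ : ∀ t, 0 ≤ t → ∀ x,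
      EqOn (fun s => g₂ (s - T₁) x) (fun s => g s x) (uIoc T₁ (T₁ + t)) := by
    intro t ht x s hs
    rw [uIoc_of_le (by linarith)] at hs
    simp [hg, hs.1.not_ge]
  have hint₁ : ∀ x, IntervalIntegrable (fun s => g s x) volume 0 T₁ := fun x =>
    (hg₁ x).congr (hgI₁ T₁ ⟨hT₁, le_rfl⟩ x)
  have hint₂ : ∀ t ∈ Icc 0 T₂, ∀ x,
      IntervalIntegrable (fun s => g s x) volume T₁ (T₁ + t) := fun t ht x => by
    have h0 : IntervalIntegrable (fun s => g₂ s x) volume 0 t :=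
      (hg₂ x).mono_set (by rw [uIcc_of_le ht.1, uIcc_of_le hT₂]; exact Icc_subset_Icc_right ht.2)
    have h1 := h0.comp_sub_right T₁
    rw [zero_add, add_comm] at h1
    exact h1.congr (hgI₂ t ht.1 x)
  have hpath₁ : ∀ t ∈ Icc 0 T₁, ∀ x,
      α x + ∫ s in (0 : ℝ)..t, g s x = α x + ∫ s in (0 : ℝ)..t, g₁ s x := fun t ht x => by
    rw [intervalIntegral.integral_congr_ae (.of_forall (hgI₁ t ht x))]
  have hpath₂ : ∀ t ∈ Icc 0 T₂, ∀ x,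
      α x + ∫ s in (0 : ℝ)..(T₁ + t), g s x = β x + ∫ s in (0 : ℝ)..t, g₂ s x := fun t ht x => by
    rw [← intervalIntegral.integral_add_adjacent_intervals (hint₁ x) (hint₂ t ht x), ← add_assoc,
      hpath₁ T₁ ⟨hT₁, le_rfl⟩, hβ, ← intervalIntegral.integral_congr_ae (.of_forall (hgI₂ t ht.1 x)),
      intervalIntegral.integral_comp_sub_right (fun s => g₂ s x)]
    simp
  have hcases : ∀ t ∈ Icc 0 (T₁ + T₂), (t ∈ Icc 0 T₁) ∨ (T₁ < t ∧ t - T₁ ∈ Icc 0 T₂) := by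
    intro t ht
    rcases le_or_gt t T₁ with h' | h'
    · exact Or.inl ⟨ht.1, h'⟩
    · exact Or.inr ⟨h', by linarith, by linarith [ht.2]⟩
  have hfun₁ : ∀ t ∈ Icc 0 T₁, (fun x => α x + ∫ s in (0 : ℝ)..t, g s x)
      = fun x => α x + ∫ s in (0 : ℝ)..t, g₁ s x := fun t ht => funext (hpath₁ t ht)
  have hfun₂ : ∀ t, t - T₁ ∈ Icc 0 T₂ → (fun x => α x + ∫ s in (0 : ℝ)..t, g s x)
      = fun x => β x + ∫ s in (0 : ℝ)..(t - T₁), g₂ s x := fun t ht => by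
    have := funext (hpath₂ _ ht)
    rwa [add_sub_cancel] at this
  refine ⟨g, ψ, h, ?_, ?_, fun x => (hint₁ x).trans (hint₂ T₂ ⟨hT₂, le_rfl⟩ x), ?_, ?_, ?_, ?_⟩
  · exact Measurable.ite measurableSet_Iic hψ₁ (hψ₂.comp (measurable_id.sub_const T₁))
  · exact Measurable.ite measurableSet_Iic hh₁ (hh₂.comp (measurable_id.sub_const T₁))
  · intro x
    rw [hpath₂ T₂ ⟨hT₂, le_rfl⟩, hγ]
  · intro t ht x
    rcases hcases t ht with h' | ⟨-, h'⟩
    · rw [hpath₁ t h']; exact hnn₁ t h' x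
    · rw [congrFun (hfun₂ t h') x]; exact hnn₂ _ h' x
  · intro t ht x
    rcases hcases t ht with h' | ⟨hlt, h'⟩
    · rw [hfun₁ t h']
      simpa [hg, hψ, hh, h'.2] using hce₁ t h' x
    · rw [hfun₂ t h']
      simpa [hg, hψ, hh, hlt.not_ge] using hce₂ _ h' x
  · have hsub : Icc 0 (T₁ + T₂) ⊆ Icc 0 T₁ ∪ ((fun t => t - T₁) ⁻¹' Icc 0 T₂ ∩ Ioi T₁) := by
      intro t ht
      rcases hcases t ht with h' | ⟨hlt, h'⟩
      exacts [Or.inl h', Or.inr ⟨h', hlt⟩]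
    refine (lintegral_mono_set hsub).trans ((lintegral_union_le _ _ _).trans ?_)
    rw [ENNReal.ofReal_add hA₁ hA₂]
    refine add_le_add (le_trans (le_of_eq ?_) hact₁) (le_trans ?_ hact₂)
    · refine setLIntegral_congr_fun measurableSet_Icc fun t ht => ?_
      simp only [hfun₁ t ht]
      simp [hψ, hh, ht.2]
    · have hm : MeasurableSet ((fun t => t - T₁) ⁻¹' Icc 0 T₂) :=
        (measurable_id.sub_const T₁) measurableSet_Icc
      have hmp := (measurePreserving_sub_right (volume : Measure ℝ) T₁).setLIntegral_comp_preimage_emb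
        (MeasurableEquiv.subRight T₁).measurableEmbedding (fun t => ENNReal.ofReal
          (a ^ 2 * h₂ t ^ 2 + b ^ 2 * C.energy
            (mobility fun x => β x + ∫ s in (0 : ℝ)..t, g₂ s x) (ψ₂ t) (ψ₂ t))) (Icc 0 T₂)
      rw [← hmp]
      refine le_trans (le_of_eq ?_) (lintegral_mono_set (inter_subset_left (t := Ioi T₁)))
      refine setLIntegral_congr_fun (hm.inter measurableSet_Ioi) fun t ht => ?_
      simp only [hfun₂ t ht.1]
      simp [hψ, hh, (show T₁ < t from ht.2).not_ge]

/-- Traversing the segment from `α` to `β` at constant speed. -/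
lemma joins_segment {T A : ℝ} (hT : 0 < T) {α β : X → ℝ} (hα : ∀ x, 0 ≤ α x)
    (hβ : ∀ x, 0 ≤ β x) {ψ : ℝ → X → ℝ} (hψ : Measurable ψ) {h : ℝ}
    (hce : ∀ t ∈ Icc 0 T, ∀ x, T⁻¹ * (β x - α x)
      + C.flow (mobility fun x => α x + t * (T⁻¹ * (β x - α x))) (ψ t) x = h * p x)
    (hact : ∀ t ∈ Icc 0 T, a ^ 2 * h ^ 2 + b ^ 2 * C.energy
      (mobility fun x => α x + t * (T⁻¹ * (β x - α x))) (ψ t) (ψ t) ≤ A / T) :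
    C.Joins a b p T α β A := by
  have hpath : ∀ t x, α x + ∫ _ in (0 : ℝ)..t, T⁻¹ * (β x - α x)
      = α x + t * (T⁻¹ * (β x - α x)) := fun t x => by
    rw [intervalIntegral.integral_const]; simp
  refine ⟨fun _ x => T⁻¹ * (β x - α x), ψ, fun _ => h, hψ, measurable_const,
    fun x => intervalIntegrable_const, fun x => ?_, fun t ht x => ?_, fun t ht x => ?_, ?_⟩
  · rw [hpath]
    field_simp
    ring
  · rw [hpath]
    have h1 : t * T⁻¹ ≤ 1 := by rw [← div_eq_mul_inv, div_le_one hT]; exact ht.2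
    have h0 : 0 ≤ t * T⁻¹ := mul_nonneg ht.1 (inv_nonneg.2 hT.le)
    nlinarith [mul_nonneg (sub_nonneg.2 h1) (hα x), mul_nonneg h0 (hβ x)]
  · simp_rw [hpath]
    exact hce t ht x
  · simp_rw [hpath]
    calc _ ≤ ∫⁻ _ in Icc 0 T, ENNReal.ofReal (A / T) :=
          setLIntegral_mono measurable_const fun t ht => ENNReal.ofReal_le_ofReal (hact t ht)
      _ = ENNReal.ofReal A := by
          rw [setLIntegral_const, Real.volume_Icc, sub_zero, ← ENNReal.ofReal_mul' hT.le,
            div_mul_cancel₀ _ hT.ne']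

/-- Mass may be created along `p` alone, without any transport; this curve may start or end at
the boundary of the cone. -/
lemma joins_source {T H : ℝ} (hT : 0 < T) {α β : X → ℝ} (hα : ∀ x, 0 ≤ α x) (hβ : ∀ x, 0 ≤ β x)
    (hαβ : ∀ x, β x - α x = H * p x) : C.Joins a b p T α β (a ^ 2 * H ^ 2 / T) := by
  have h0 : ∀ w, C.flow w 0 = 0 := fun w => by
    have := C.flow_smul w 0 0
    simpa using this
  have h1 : ∀ w, C.energy w 0 0 = 0 := fun w => by simp [energy, grad]
  refine joins_segment (ψ := fun _ => 0) (h := T⁻¹ * H) hT hα hβ measurable_const ?_ ?_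
  · intro t _ x
    rw [h0, hαβ]
    simp [mul_assoc]
  · intro t _
    rw [h1]
    refine le_of_eq ?_
    field_simp
    ring

/-- A step with increment `H p - F` between positive densities. The transported part `F` is
realised at each time by the gradient flux solving the Poisson equation; the hypothesis on `F`
is the dual form of the bound `B` on the energy of that flux. -/
lemma joins_step {T H B : ℝ} (hT : 0 < T) {α β F : X → ℝ} (hα : ∀ x, 0 < α x)
    (hβ : ∀ x, 0 < β x) (hαβ : ∀ x, β x - α x = H * p x - F x) (hF : C.pairing 1 F = 0)
    (hB : ∀ s ∈ Icc (0 : ℝ) 1, ∀ η, -2 * C.pairing F η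
      ≤ B + C.energy (mobility fun x => α x + s * (β x - α x)) η η) :
    C.Joins a b p T α β ((a ^ 2 * H ^ 2 + b ^ 2 * B) / T) := by
  set w : ℝ → X → X → ℝ := fun t => mobility fun x => α x + t * (T⁻¹ * (β x - α x)) with hw
  have hs : ∀ t ∈ Icc 0 T, t * T⁻¹ ∈ Icc (0 : ℝ) 1 := fun t ht =>
    ⟨mul_nonneg ht.1 (inv_nonneg.2 hT.le), by
      rw [← div_eq_mul_inv, div_le_one hT]; exact ht.2⟩
  have hwpos : ∀ t ∈ Icc 0 T, ∀ x y, 0 < w t x y := by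
    intro t ht
    refine mobility_pos fun x => ?_
    have h0 := (hs t ht).1
    have h1 := (hs t ht).2
    have h2 : α x + t * (T⁻¹ * (β x - α x)) = (1 - t * T⁻¹) * α x + t * T⁻¹ * β x := by ring
    rw [h2]
    rcases h0.eq_or_lt with h0 | h0
    · rw [← h0]; simpa using hα x
    · have := mul_pos h0 (hβ x)
      have := mul_nonneg (sub_nonneg.2 h1) (hα x).le
      linarith
  have hflow : ∀ t ∈ Icc 0 T, C.flow (w t) (C.poissonSol (w t) (T⁻¹ • F)) = T⁻¹ • F :=
    fun t ht => C.flow_poissonSol (hwpos t ht) (by rw [pairing_smul_right, hF, mul_zero])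
  refine joins_segment (ψ := fun t => C.poissonSol (w t) (T⁻¹ • F)) (h := T⁻¹ * H) hT
    (fun x => (hα x).le) (fun x => (hβ x).le) ?_ ?_ ?_
  · refine (C.measurable_poissonSol _).comp (measurable_mobility fun x => ?_)
    fun_prop
  · intro t ht x
    have := congrFun (hflow t ht) x
    simp only [hw] at this ⊢
    rw [this, hαβ]
    simp only [Pi.smul_apply, smul_eq_mul]
    ring
  · intro t ht
    -- Testing the hypothesis on `F` with the potential `T ψ` bounds the energy of `ψ`.
    set ψ := C.poissonSol (w t) (T⁻¹ • F) with hψ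
    have h1 : C.pairing F ψ = -(T * C.energy (w t) ψ ψ) := by
      have := C.pairing_flow (w t) ψ ψ
      rw [hψ, hflow t ht, ← hψ, pairing_smul_right, C.pairing_comm] at this
      field_simp at this
      linarith
    have h2 := hB _ (hs t ht) (T • ψ)
    have h3 : (mobility fun x => α x + t * T⁻¹ * (β x - α x)) = w t := by
      simp only [hw, mul_assoc]
    rw [h3, pairing_smul_right, energy_smul_left, energy_smul_right, h1] at h2
    have h4 : T ^ 2 * C.energy (w t) ψ ψ ≤ B := by nlinarith
    change a ^ 2 * (T⁻¹ * H) ^ 2 + b ^ 2 * C.energy (w t) ψ ψ ≤ _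
    rw [div_div, le_div_iff₀ (by positivity)]
    have h5 : (a ^ 2 * (T⁻¹ * H) ^ 2 + b ^ 2 * C.energy (w t) ψ ψ) * (T * T)
        = a ^ 2 * H ^ 2 + b ^ 2 * (T ^ 2 * C.energy (w t) ψ ψ) := by
      field_simp
    rw [h5]
    gcongr

variable (C)

/-- Any two densities are joined by a curve of finite action: both are raised by `p`, and the
raised densities are joined by a segment in the interior of the cone. -/
lemma exists_joins (a b : ℝ) {p : X → ℝ} (hp : p ∈ posDensities X) (hp1 : C.l1Norm p = 1)
    {μ₀ μ₁ : X → ℝ} (hμ₀ : ∀ x, 0 ≤ μ₀ x) (hμ₁ : ∀ x, 0 ≤ μ₁ x) :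
    ∃ A, C.Joins a b p 1 μ₀ μ₁ A := by
  set H := C.pairing 1 (μ₁ - μ₀) with hH
  set F : X → ℝ := H • p - (μ₁ - μ₀) with hFd
  have hF : C.pairing 1 F = 0 := by
    rw [hFd, pairing_sub_right, pairing_smul_right, C.pairing_one_eq_one hp hp1, ← hH]
    ring
  set ψ := C.poissonSol (mobility p) F
  have hψ : C.flow (mobility p) ψ = F := C.flow_poissonSol (mobility_pos hp) hF
  have hp0 : ∀ x, 0 ≤ p x := fun x => (hp x).le
  have hB0 := C.energy_nonneg (mobility_nonneg hp0) ψ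
  have J₁ : C.Joins a b p (1 / 3) μ₀ (μ₀ + p) (a ^ 2 * 1 ^ 2 / (1 / 3)) :=
    joins_source (by norm_num) hμ₀ (fun x => add_nonneg (hμ₀ x) (hp0 x)) fun x => by simp
  have J₃ : C.Joins a b p (1 / 3) (μ₁ + p) μ₁ (a ^ 2 * (-1) ^ 2 / (1 / 3)) :=
    joins_source (by norm_num) (fun x => add_nonneg (hμ₁ x) (hp0 x)) hμ₁ fun x => by simp
  have J₂ : C.Joins a b p (1 / 3) (μ₀ + p) (μ₁ + p)
      ((a ^ 2 * H ^ 2 + b ^ 2 * C.energy (mobility p) ψ ψ) / (1 / 3)) := by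
    refine joins_step (F := F) (by norm_num) (fun x => add_pos_of_nonneg_of_pos (hμ₀ x) (hp x))
      (fun x => add_pos_of_nonneg_of_pos (hμ₁ x) (hp x)) (fun x => ?_) hF fun s hs η => ?_
    · simp [hFd]
    -- The segment stays above `p`, so that its weights dominate those of `p`.
    · have h1 : C.pairing F η = -C.energy (mobility p) ψ η := by
        rw [C.pairing_comm, ← hψ, pairing_flow]
      have h2 := C.two_mul_energy_le (mobility_nonneg hp0) ψ η
      have h3 := C.energy_mono (mobility_mono (ν := fun x => (μ₀ + p) x
        + s * ((μ₁ + p) x - (μ₀ + p) x)) hp0 fun x => by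
          simp only [Pi.add_apply]
          nlinarith [mul_nonneg hs.1 (hμ₁ x), mul_nonneg (sub_nonneg.2 hs.2) (hμ₀ x)]) η
      linarith
  have J := (J₁.trans (by norm_num) (by norm_num) (by positivity) (by positivity) J₂).trans
    (by norm_num) (by norm_num) (by positivity) (by positivity) J₃
  norm_num at J
  exact ⟨_, J⟩

/-- A joining curve on `[0,1]` gives an admissible triple, by Lebesgue differentiation of the
primitive of `g`. -/
lemma iInf_action_le {μ₀ μ₁ : X → ℝ} {A : ℝ} (hJ : C.Joins a b p 1 μ₀ μ₁ A) :
    (⨅ (μ : ℝ → X → ℝ) (ψ : ℝ → X → ℝ) (h : ℝ → ℝ) (_ : C.IsAdmissible p μ₀ μ₁ μ ψ h),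
      C.action a b μ ψ h) ≤ ENNReal.ofReal A := by
  obtain ⟨g, ψ, h, hψ, hh, hg, hend, hnn, hce, hact⟩ := hJ
  set μ : ℝ → X → ℝ := fun t x => μ₀ x + ∫ s in (0 : ℝ)..t, g s x with hμ
  have hadm : C.IsAdmissible p μ₀ μ₁ μ ψ h := by
    refine ⟨hnn, fun x => ?_, hψ, hh, ?_, by simp [hμ], funext hend⟩
    · have hc : AbsolutelyContinuousOnInterval (fun _ : ℝ => μ₀ x) 0 1 :=
        ((LipschitzWith.const (μ₀ x)).lipschitzOnWith).absolutelyContinuousOnInterval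
      exact hc.fun_add ((hg x).absolutelyContinuousOnInterval_intervalIntegral (c := 0) (by simp))
    · have hd : ∀ x, ∀ᵐ t : ℝ, t ∈ uIcc (0 : ℝ) 1 →
          HasDerivAt (fun s => μ s x) (g t x) t := by
        intro x
        filter_upwards [(hg x).ae_hasDerivAt_integral] with t ht htI
        exact (ht htI 0 (by simp)).const_add _
      rw [ae_restrict_iff' measurableSet_Icc]
      filter_upwards [ae_all_iff.2 hd] with t ht htI x
      rw [(ht x (by rwa [uIcc_of_le zero_le_one])).deriv]
      exact hce t htI x
  refine le_trans (iInf_le_of_le μ (iInf_le_of_le ψ (iInf_le_of_le h (iInf_le _ hadm)))) ?_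
  refine le_trans (le_of_eq ?_) hact
  unfold action
  rw [← lintegral_const_mul _ (by fun_prop), ← lintegral_const_mul' _ _ (by simp),
    ← lintegral_add_left (by fun_prop)]
  refine setLIntegral_congr_fun measurableSet_Icc fun t ht => ?_
  have he := C.energy_nonneg (mobility_nonneg (hnn t ht)) (ψ t)
  rw [C.normMu_sq (hnn t ht), ← ENNReal.ofReal_mul (sq_nonneg a), ← ENNReal.ofReal_mul (sq_nonneg b),
    ← ENNReal.ofReal_add (by positivity) (by positivity)]

end RevChain

/-! ### Piecewise linear interpolation -/

section Interpolation

variable {X : Type*}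

/-- The piecewise linear curve on `[0,1]` through the nodes `φ k` at the times `k / n`. It is a sum
of increments, each multiplied by the fraction of its cell that has elapsed, and thus manifestly
continuous in `t`. -/
def interp (n : ℕ) (φ : ℕ → X → ℝ) (t : ℝ) (x : X) : ℝ :=
  φ 0 x + ∑ k ∈ Finset.range n, (φ (k + 1) x - φ k x) * max 0 (min 1 (n * t - k))

lemma continuous_interp (n : ℕ) (φ : ℕ → X → ℝ) (x : X) :
    Continuous fun t => interp n φ t x := by
  unfold interp
  fun_prop

lemma interp_eq {n k : ℕ} (hk : k < n) (φ : ℕ → X → ℝ) {t : ℝ} (h0 : (k : ℝ) ≤ n * t)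
    (h1 : n * t ≤ k + 1) :
    interp n φ t = (1 - (n * t - k)) • φ k + (n * t - k) • φ (k + 1) := by
  funext x
  have hsub : Finset.range (k + 1) ⊆ Finset.range n := Finset.range_subset_range.2 hk
  have hsum : ∑ j ∈ Finset.range n, (φ (j + 1) x - φ j x) * max 0 (min 1 (n * t - j))
      = ∑ j ∈ Finset.range (k + 1), (φ (j + 1) x - φ j x) * max 0 (min 1 (n * t - j)) := by
    refine (Finset.sum_subset hsub fun j _ hj => ?_).symm
    have hj' : (k : ℝ) + 1 ≤ j := by
      rw [Finset.mem_range, not_lt] at hj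
      exact_mod_cast hj
    rw [max_eq_left ((min_le_right _ _).trans (by linarith)), mul_zero]
  have hsum' : ∑ j ∈ Finset.range k, (φ (j + 1) x - φ j x) * max 0 (min 1 (n * t - j))
      = ∑ j ∈ Finset.range k, (φ (j + 1) x - φ j x) := by
    refine Finset.sum_congr rfl fun j hj => ?_
    have hj' : (j : ℝ) + 1 ≤ k := by exact_mod_cast Finset.mem_range.1 hj
    rw [min_eq_left (by linarith), max_eq_right zero_le_one, mul_one]
  rw [interp, hsum, Finset.sum_range_succ, hsum', Finset.sum_range_sub (fun j => φ j x),
    min_eq_right (by linarith), max_eq_right (by linarith)]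
  simp only [Pi.add_apply, Pi.smul_apply, smul_eq_mul]
  ring

lemma interp_zero {n : ℕ} (hn : 0 < n) (φ : ℕ → X → ℝ) : interp n φ 0 = φ 0 := by
  rw [interp_eq hn φ (by simp) (by simp)]
  simp

lemma interp_one {n : ℕ} (hn : 0 < n) (φ : ℕ → X → ℝ) : interp n φ 1 = φ n := by
  obtain ⟨m, rfl⟩ : ∃ m, n = m + 1 := ⟨n - 1, by omega⟩
  rw [interp_eq (Nat.lt_succ_self m) φ (by push_cast; linarith) (by push_cast; linarith)]
  push_cast
  simp

lemma mem_cell {n k : ℕ} (hn : 0 < n) {t : ℝ} (ht : t ∈ Icc ((k : ℝ) / n) ((k + 1 : ℝ) / n)) :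
    (k : ℝ) ≤ n * t ∧ n * t ≤ k + 1 := by
  have hn' : (0 : ℝ) < n := by exact_mod_cast hn
  constructor
  · rw [mul_comm]; exact (div_le_iff₀ hn').1 ht.1
  · rw [mul_comm]; exact (le_div_iff₀ hn').1 ht.2

/-- The trapezoidal rule overestimates the integral of the square of a piecewise linear
function. -/
lemma integral_sq_interp_le {n : ℕ} (hn : 0 < n) (u : ℕ → ℝ) {f : ℝ → ℝ} (hf : Continuous f)
    (h : ∀ k < n, ∀ t ∈ Icc ((k : ℝ) / n) ((k + 1 : ℝ) / n),
      f t = (1 - (n * t - k)) * u k + (n * t - k) * u (k + 1)) :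
    ∫ t in (0 : ℝ)..1, f t ^ 2
      ≤ ∑ k ∈ Finset.range n, (n : ℝ)⁻¹ / 2 * (u k ^ 2 + u (k + 1) ^ 2) := by
  have hn' : (0 : ℝ) < n := by exact_mod_cast hn
  have hsplit := intervalIntegral.sum_integral_adjacent_intervals (μ := volume)
    (f := fun t => f t ^ 2) (a := fun k : ℕ => (k : ℝ) / n) (n := n)
    fun k _ => (hf.pow 2).intervalIntegrable _ _
  simp only [Nat.cast_zero, zero_div, div_self hn'.ne'] at hsplit
  rw [← hsplit]
  refine Finset.sum_le_sum fun k hk => ?_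
  have hk := Finset.mem_range.1 hk
  push_cast
  have hle : (k : ℝ) / n ≤ (k + 1 : ℝ) / n := by gcongr; linarith
  -- On each cell the square is at most the linear interpolation of its values at the ends.
  have hval : ∫ t in ((k : ℝ) / n)..((k + 1 : ℝ) / n),
      ((1 - (n * t - k)) * u k ^ 2 + (n * t - k) * u (k + 1) ^ 2)
      = (n : ℝ)⁻¹ / 2 * (u k ^ 2 + u (k + 1) ^ 2) := by
    rw [intervalIntegral.integral_comp_mul_sub
      (fun r => (1 - r) * u k ^ 2 + r * u (k + 1) ^ 2) hn'.ne' (k : ℝ)]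
    have e1 : (n : ℝ) * (k / n) - k = 0 := by field_simp; ring
    have e2 : (n : ℝ) * ((k + 1) / n) - k = 1 := by field_simp; ring
    rw [e1, e2, intervalIntegral.integral_add (Continuous.intervalIntegrable (by fun_prop) _ _)
        (Continuous.intervalIntegrable (by fun_prop) _ _),
      intervalIntegral.integral_mul_const, intervalIntegral.integral_mul_const,
      intervalIntegral.integral_sub intervalIntegrable_const
        (Continuous.intervalIntegrable (by fun_prop) _ _), integral_id]
    simp
    ring
  rw [← hval]
  refine intervalIntegral.integral_mono_on hle ((hf.pow 2).intervalIntegrable _ _)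
    (Continuous.intervalIntegrable (by fun_prop) _ _) fun t ht => ?_
  have h1 := mem_cell hn ht
  rw [h k hk t ht]
  nlinarith [mul_nonneg (mul_nonneg (sub_nonneg.2 h1.1) (sub_nonneg.2 h1.2))
    (sq_nonneg (u k - u (k + 1)))]

end Interpolation

namespace RevChain

variable {X : Type*} [Fintype X] (C : RevChain X)

lemma continuous_pairing_left {Φ : ℝ → X → ℝ} (hΦ : ∀ x, Continuous fun t => Φ t x) (q : X → ℝ) :
    Continuous fun t => C.pairing (Φ t) q := by
  unfold pairing
  fun_prop

lemma continuous_energy {Φ : ℝ → X → ℝ} (hΦ : ∀ x, Continuous fun t => Φ t x)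
    (w : X → X → ℝ) : Continuous fun t => C.energy w (Φ t) (Φ t) := by
  unfold energy grad
  fun_prop

/-- Along the interpolation of nodes satisfying the discrete Hamilton–Jacobi inequality at both
ends of each cell, `⟨Φ_t,μ⟩ + (1/(2b²)) ∫₀ᵗ ‖∇Φ‖²_μ` decreases: on each cell the rate of
change is constant and the energy is convex, so that the worst case is at an end. -/
lemma antitoneOn_interp {n : ℕ} (hn : 0 < n) {b : ℝ} {φ : ℕ → X → ℝ} {μ : X → ℝ}
    (hμ : ∀ x, 0 ≤ μ x)
    (h : ∀ k < n, ∀ j ∈ ({k, k + 1} : Set ℕ), C.pairing (φ (k + 1) - φ k) μ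
      + (n : ℝ)⁻¹ * (1 / (2 * b ^ 2)) * C.energy (mobility μ) (φ j) (φ j) ≤ 0) :
    AntitoneOn (fun t => C.pairing (interp n φ t) μ + 1 / (2 * b ^ 2) *
      ∫ s in (0 : ℝ)..t, C.energy (mobility μ) (interp n φ s) (interp n φ s)) (Icc 0 1) := by
  have hn' : (0 : ℝ) < n := by exact_mod_cast hn
  have hcont := C.continuous_energy (continuous_interp n φ) (mobility μ)
  set e : ℝ → ℝ := fun s => C.energy (mobility μ) (interp n φ s) (interp n φ s) with he
  set G : ℝ → ℝ := fun t => C.pairing (interp n φ t) μ + 1 / (2 * b ^ 2) * ∫ s in (0 : ℝ)..t, e s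
    with hG
  have hcell : ∀ k < n, AntitoneOn G (Icc ((k : ℝ) / n) ((k + 1 : ℝ) / n)) := by
    intro k hk u hu v hv huv
    have hu' := mem_cell hn hu
    have hv' := mem_cell hn hv
    have hE : ∀ s ∈ Icc u v, 1 / (2 * b ^ 2) * e s ≤ -(n * C.pairing (φ (k + 1) - φ k) μ) := by
      intro s hs
      have hs' := mem_cell hn (t := s) ⟨hu.1.trans hs.1, hs.2.trans hv.2⟩
      have h3 := C.energy_convex (mobility_nonneg hμ) (φ k) (φ (k + 1))
        (sub_nonneg.2 (by linarith : n * s - k ≤ 1)) (sub_nonneg.2 hs'.1) (by ring)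
      rw [← interp_eq hk φ hs'.1 hs'.2] at h3
      have hj : ∀ j ∈ ({k, k + 1} : Set ℕ), 1 / (2 * b ^ 2) * C.energy (mobility μ) (φ j) (φ j)
          ≤ -(n * C.pairing (φ (k + 1) - φ k) μ) := by
        intro j hj
        have := mul_le_mul_of_nonneg_left (h k hk j hj) hn'.le
        rw [mul_add, mul_zero, mul_assoc, ← mul_assoc, mul_inv_cancel₀ hn'.ne', one_mul] at this
        linarith
      have hb : 0 ≤ 1 / (2 * b ^ 2) := by positivity
      calc 1 / (2 * b ^ 2) * e s ≤ 1 / (2 * b ^ 2) *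
            ((1 - (n * s - k)) * C.energy (mobility μ) (φ k) (φ k)
              + (n * s - k) * C.energy (mobility μ) (φ (k + 1)) (φ (k + 1))) := by
            gcongr
        _ = (1 - (n * s - k)) * (1 / (2 * b ^ 2) * C.energy (mobility μ) (φ k) (φ k))
              + (n * s - k) * (1 / (2 * b ^ 2)
                * C.energy (mobility μ) (φ (k + 1)) (φ (k + 1))) := by ring
        _ ≤ (1 - (n * s - k)) * -(n * C.pairing (φ (k + 1) - φ k) μ)
              + (n * s - k) * -(n * C.pairing (φ (k + 1) - φ k) μ) := by
            have := mul_le_mul_of_nonneg_left (hj k (by simp)) (sub_nonneg.2 (by linarith : n * s - k ≤ 1))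
            have := mul_le_mul_of_nonneg_left (hj (k + 1) (by simp)) (sub_nonneg.2 hs'.1)
            linarith
        _ = _ := by ring
    have hint : 1 / (2 * b ^ 2) * ∫ s in u..v, e s
        ≤ (v - u) * -(n * C.pairing (φ (k + 1) - φ k) μ) := by
      rw [← intervalIntegral.integral_const_mul]
      refine (intervalIntegral.integral_mono_on huv
        ((continuous_const.mul hcont).intervalIntegrable _ _) intervalIntegrable_const hE).trans ?_
      rw [intervalIntegral.integral_const, smul_eq_mul]
    have hsub : ∫ s in u..v, e s = (∫ s in (0 : ℝ)..v, e s) - ∫ s in (0 : ℝ)..u, e s :=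
      (intervalIntegral.integral_interval_sub_left (hcont.intervalIntegrable _ _)
        (hcont.intervalIntegrable _ _)).symm
    have hpair : C.pairing (interp n φ v) μ - C.pairing (interp n φ u) μ
        = (v - u) * (n * C.pairing (φ (k + 1) - φ k) μ) := by
      rw [interp_eq hk φ hu'.1 hu'.2, interp_eq hk φ hv'.1 hv'.2]
      simp only [pairing_add_left, pairing_smul_left, pairing_sub_left]
      ring
    rw [hsub] at hint
    simp only [hG]
    linarith
  -- Glue the cells together.
  have hall : ∀ k ≤ n, AntitoneOn G (Icc 0 ((k : ℝ) / n)) := by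
    intro k
    induction k with
    | zero => simp [AntitoneOn]
    | succ k ih =>
      intro hk
      have hk0 : (0 : ℝ) ≤ (k : ℝ) / n := by positivity
      have hk1 : (k : ℝ) / n ≤ (k + 1 : ℝ) / n := by gcongr; linarith
      have := (ih (by omega)).union_right (hcell k (by omega)) (isGreatest_Icc hk0)
        (isLeast_Icc hk1)
      rw [Icc_union_Icc_eq_Icc hk0 hk1] at this
      exact_mod_cast this
  have := hall n le_rfl
  rwa [div_self hn'.ne'] at this

/-! ### Regularisation of subsolutions in time -/

/-- Jensen's inequality for the energy of a time average. -/
lemma energy_average_le {Φ : ℝ → X → ℝ} (hΦ : ∀ x, Continuous fun t => Φ t x)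
    {w : X → X → ℝ} (hw : ∀ x y, 0 ≤ w x y) {u v : ℝ} (huv : u < v) {m : X → ℝ}
    (hm : ∀ x, (v - u) * m x = ∫ s in u..v, Φ s x) :
    (v - u) * C.energy w m m ≤ ∫ s in u..v, C.energy w (Φ s) (Φ s) := by
  have hc := C.continuous_pairing_left hΦ (C.flow w m)
  -- The energy lies above its tangent at the average `m`.
  have hle : ∀ s, -2 * C.pairing (Φ s) (C.flow w m) - C.energy w m m
      ≤ C.energy w (Φ s) (Φ s) := fun s => by
    have := C.two_mul_energy_le hw m (Φ s)
    rw [pairing_flow]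
    linarith
  have hint : ∫ s in u..v, C.pairing (Φ s) (C.flow w m) = (v - u) * C.pairing m (C.flow w m) := by
    have hI : ∀ x ∈ Finset.univ, IntervalIntegrable
        (fun s => Φ s x * C.flow w m x * C.ϖ x) volume u v := fun x _ =>
      (((hΦ x).mul continuous_const).mul continuous_const).intervalIntegrable _ _
    unfold pairing
    rw [intervalIntegral.integral_finsetSum hI, Finset.mul_sum]
    refine Finset.sum_congr rfl fun x _ => ?_
    rw [intervalIntegral.integral_mul_const, intervalIntegral.integral_mul_const, ← hm]
    ring
  have hI : IntervalIntegrable (fun s => -2 * C.pairing (Φ s) (C.flow w m)) volume u v :=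
    (continuous_const.mul hc).intervalIntegrable _ _
  have h := intervalIntegral.integral_mono_on huv.le (hI.sub intervalIntegrable_const)
    ((C.continuous_energy hΦ w).intervalIntegrable u v) fun s _ => hle s
  rw [intervalIntegral.integral_sub hI intervalIntegrable_const, intervalIntegral.integral_const_mul, hint, pairing_flow,
    intervalIntegral.integral_const, smul_eq_mul] at h
  linarith

end RevChain

section Mollify

variable {X : Type*}

/-- The average of `Φ` over the window of length `σ` starting at `(1-σ)t`, damped by `1-σ`. The
window stays in `[0,1]`, and the damping compensates for the change of the time scale in the
Hamilton–Jacobi inequality. -/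
def mollify (Φ : ℝ → X → ℝ) (σ t : ℝ) (x : X) : ℝ :=
  (1 - σ) * ∫ r in (0 : ℝ)..1, Φ ((1 - σ) * t + σ * r) x

variable {Φ : ℝ → X → ℝ}

/-- At `σ = 0` the average degenerates to `Φ` itself, so that the dual values of the averages
converge to that of `Φ` by continuity in `σ`. -/
lemma mollify_zero (Φ : ℝ → X → ℝ) : mollify Φ 0 = Φ := by
  funext t x
  simp [mollify]

/-- Joint continuity in the window length and in time. -/
lemma continuous_mollify (hΦ : ∀ x, Continuous fun t => Φ t x) (x : X) :
    Continuous fun q : ℝ × ℝ => mollify Φ q.1 q.2 x := by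
  unfold mollify
  refine (by fun_prop : Continuous fun q : ℝ × ℝ => 1 - q.1).mul ?_
  refine intervalIntegral.continuous_parametric_intervalIntegral_of_continuous' ?_ 0 1
  exact (hΦ x).comp (by fun_prop)

lemma mollify_eq {σ : ℝ} (hσ : σ ≠ 0) (t : ℝ) (x : X) :
    mollify Φ σ t x
      = (1 - σ) * (σ⁻¹ * ∫ s in ((1 - σ) * t)..((1 - σ) * t + σ), Φ s x) := by
  rw [mollify, intervalIntegral.integral_comp_add_mul (fun s => Φ s x) hσ]
  simp

lemma hasDerivAt_mollify (hΦ : ∀ x, Continuous fun t => Φ t x) {σ : ℝ} (hσ : σ ≠ 0) (t : ℝ)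
    (x : X) : HasDerivAt (fun t => mollify Φ σ t x)
      ((1 - σ) ^ 2 * σ⁻¹ * (Φ ((1 - σ) * t + σ) x - Φ ((1 - σ) * t) x)) t := by
  have hP : ∀ u, HasDerivAt (fun u => ∫ s in (0 : ℝ)..u, Φ s x) (Φ u x) u := fun u =>
    ((hΦ x).integral_hasStrictDerivAt 0 u).hasDerivAt
  have h1 : HasDerivAt (fun t : ℝ => (1 - σ) * t) (1 - σ) t := by
    simpa using (hasDerivAt_id t).const_mul (1 - σ)
  have h := ((((hP ((1 - σ) * t + σ)).comp t (h1.add_const σ)).sub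
    ((hP ((1 - σ) * t)).comp t h1)).const_mul σ⁻¹).const_mul (1 - σ)
  have hfun : (fun t => mollify Φ σ t x) = fun t => (1 - σ) * (σ⁻¹ *
      (((fun u => ∫ s in (0 : ℝ)..u, Φ s x) ∘ fun t => (1 - σ) * t + σ)
        - ((fun u => ∫ s in (0 : ℝ)..u, Φ s x) ∘ fun t => (1 - σ) * t)) t) := by
    funext t
    rw [mollify_eq hσ]
    simp only [Pi.sub_apply, Function.comp_apply]
    rw [intervalIntegral.integral_interval_sub_left ((hΦ x).intervalIntegrable _ _)
      ((hΦ x).intervalIntegrable _ _)]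
  rw [hfun]
  exact h.congr_deriv (by ring)

lemma isC1_mollify (hΦ : ∀ x, Continuous fun t => Φ t x) {σ : ℝ} (hσ : σ ≠ 0) (T : ℝ) :
    IsC1 T (mollify Φ σ) := by
  intro x
  refine ContDiff.contDiffOn (contDiff_one_iff_deriv.2
    ⟨fun t => (hasDerivAt_mollify hΦ hσ t x).differentiableAt, ?_⟩)
  have : deriv (fun t => mollify Φ σ t x) = fun t =>
      (1 - σ) ^ 2 * σ⁻¹ * (Φ ((1 - σ) * t + σ) x - Φ ((1 - σ) * t) x) :=
    funext fun t => (hasDerivAt_mollify hΦ hσ t x).deriv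
  rw [this]
  have := hΦ x
  fun_prop

end Mollify

namespace RevChain

variable {X : Type*} [Fintype X] (C : RevChain X)

/-- The average of a curve that satisfies the Hamilton–Jacobi inequality in integrated form
satisfies it at every time: the derivative of the average is the difference quotient over the
window, and Jensen's inequality bounds the energy of the average. -/
lemma satisfiesHJ_mollify {Φ : ℝ → X → ℝ} (hΦ : ∀ x, Continuous fun t => Φ t x) {b : ℝ}
    (h : ∀ μ : X → ℝ, (∀ x, 0 ≤ μ x) → AntitoneOn (fun t => C.pairing (Φ t) μ
      + 1 / (2 * b ^ 2) * ∫ s in (0 : ℝ)..t, C.energy (mobility μ) (Φ s) (Φ s)) (Icc 0 1))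
    {σ : ℝ} (hσ : 0 < σ) (hσ1 : σ < 1) : C.SatisfiesHJ 1 b (mollify Φ σ) := by
  refine (ae_restrict_iff' measurableSet_Ioo).2 (.of_forall fun t ht μ hμ => ?_)
  have hμ : ∀ x, 0 ≤ μ x := hμ
  rw [C.normMu_sq hμ]
  set u := (1 - σ) * t with hu
  have hu0 : 0 ≤ u := mul_nonneg (by linarith) ht.1.le
  have hu1 : u + σ ≤ 1 := by nlinarith [ht.2]
  set e : ℝ → ℝ := fun s => C.energy (mobility μ) (Φ s) (Φ s) with he
  have hec : Continuous e := C.continuous_energy hΦ _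
  have hanti := h μ hμ (a := u) ⟨hu0, by linarith⟩ (b := u + σ) ⟨by linarith, hu1⟩ (by linarith)
  simp only at hanti
  have hsub : ∫ s in u..(u + σ), e s
      = (∫ s in (0 : ℝ)..(u + σ), e s) - ∫ s in (0 : ℝ)..u, e s :=
    (intervalIntegral.integral_interval_sub_left (hec.intervalIntegrable _ _)
      (hec.intervalIntegrable _ _)).symm
  have hderiv : (fun x => deriv (fun s => mollify Φ σ s x) t)
      = ((1 - σ) ^ 2 * σ⁻¹) • (Φ (u + σ) - Φ u) := by
    funext x
    rw [(hasDerivAt_mollify hΦ hσ.ne' t x).deriv]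
    simp [hu]
  set m : X → ℝ := fun x => σ⁻¹ * ∫ s in u..(u + σ), Φ s x with hm
  have hmol : mollify Φ σ t = (1 - σ) • m := funext fun x => by
    rw [mollify_eq hσ.ne']; rfl
  have hjensen := C.energy_average_le hΦ (mobility_nonneg hμ) (u := u) (v := u + σ) (by linarith)
    (m := m) fun x => by simp [hm, hσ.ne']
  rw [add_sub_cancel_left] at hjensen
  rw [hderiv, hmol, pairing_smul_left, energy_smul_left, energy_smul_right, pairing_sub_left]
  have hb : 0 ≤ 1 / (2 * b ^ 2) := by positivity
  have h1 : C.pairing (Φ (u + σ)) μ - C.pairing (Φ u) μ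
      ≤ -(1 / (2 * b ^ 2) * (σ * C.energy (mobility μ) m m)) := by
    have := mul_le_mul_of_nonneg_left hjensen hb
    rw [hsub] at this
    linarith
  have h2 := mul_le_mul_of_nonneg_left h1 (by positivity : 0 ≤ (1 - σ) ^ 2 * σ⁻¹)
  have h3 : (1 - σ) ^ 2 * σ⁻¹ * -(1 / (2 * b ^ 2) * (σ * C.energy (mobility μ) m m))
      = -(1 / (2 * b ^ 2) * ((1 - σ) * ((1 - σ) * C.energy (mobility μ) m m))) := by
    field_simp
  linarith

lemma continuous_dualValue_mollify {Φ : ℝ → X → ℝ} (hΦ : ∀ x, Continuous fun t => Φ t x)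
    (a : ℝ) (p μ₀ μ₁ : X → ℝ) :
    Continuous fun σ => C.dualValue a p μ₀ μ₁ (mollify Φ σ) := by
  have hm := continuous_mollify hΦ
  have h1 : ∀ (t : ℝ) (q : X → ℝ), Continuous fun σ => C.pairing (mollify Φ σ t) q := fun t q =>
    C.continuous_pairing_left
      (fun x => (hm x).comp (by fun_prop : Continuous fun σ : ℝ => (σ, t))) q
  have h2 : Continuous fun q : ℝ × ℝ => C.pairing (mollify Φ q.1 q.2) p ^ 2 := by
    unfold pairing
    fun_prop
  unfold dualValue
  exact ((h1 1 μ₁).sub (h1 0 μ₀)).sub (continuous_const.mul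
    (intervalIntegral.continuous_parametric_intervalIntegral_of_continuous' h2 0 1))

/-- The discrete dual problem underestimates the continuous one, even for subsolutions of class
`C¹`: interpolate the nodes, then regularise in time. -/
lemma exists_isC1_dualValue_gt {n : ℕ} (hn : 0 < n) {a b : ℝ} (p μ₀ μ₁ : X → ℝ)
    {φ : ℕ → X → ℝ}
    (h : ∀ k < n, ∀ j ∈ ({k, k + 1} : Set ℕ), ∀ μ : X → ℝ, (∀ x, 0 ≤ μ x) →
      C.pairing (φ (k + 1) - φ k) μ
        + (n : ℝ)⁻¹ * (1 / (2 * b ^ 2)) * C.energy (mobility μ) (φ j) (φ j) ≤ 0)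
    {c : ℝ} (hc : c < C.pairing (φ n) μ₁ - C.pairing (φ 0) μ₀ - 1 / (2 * a ^ 2) *
      ∑ k ∈ Finset.range n, (n : ℝ)⁻¹ / 2 *
        (C.pairing (φ k) p ^ 2 + C.pairing (φ (k + 1)) p ^ 2)) :
    ∃ Ψ, IsC1 1 Ψ ∧ C.SatisfiesHJ 1 b Ψ ∧ c < C.dualValue a p μ₀ μ₁ Ψ := by
  set Φ := interp n φ with hΦd
  have hΦ : ∀ x, Continuous fun t => Φ t x := continuous_interp n φ
  have hval : c < C.dualValue a p μ₀ μ₁ Φ := by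
    refine hc.trans_le ?_
    rw [dualValue, hΦd, interp_zero hn, interp_one hn]
    have := integral_sq_interp_le hn (fun k => C.pairing (φ k) p)
      (C.continuous_pairing_left hΦ p) fun k hk t ht => by
        have ht' := mem_cell hn ht
        rw [hΦd, interp_eq hk φ ht'.1 ht'.2, pairing_add_left, pairing_smul_left,
          pairing_smul_left]
    have ha : 0 ≤ 1 / (2 * a ^ 2) := by positivity
    gcongr
  have hcont := C.continuous_dualValue_mollify hΦ a p μ₀ μ₁
  have hev : ∀ᶠ σ in nhds (0 : ℝ), c < C.dualValue a p μ₀ μ₁ (mollify Φ σ) :=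
    hcont.continuousAt.eventually (lt_mem_nhds (by simpa only [mollify_zero] using hval))
  obtain ⟨σ, hσc, hσ⟩ : ∃ σ, c < C.dualValue a p μ₀ μ₁ (mollify Φ σ) ∧ σ ∈ Ioo (0 : ℝ) 1 :=
    ((hev.filter_mono nhdsWithin_le_nhds).and (Ioo_mem_nhdsGT one_pos)).exists
  refine ⟨mollify Φ σ, isC1_mollify hΦ hσ.1.ne' 1, C.satisfiesHJ_mollify hΦ (fun μ hμ => ?_)
    hσ.1 hσ.2, hσc⟩
  exact C.antitoneOn_interp hn hμ fun k hk j hj => h k hk j hj μ hμ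

end RevChain

/-! ### The time-discrete saddle point problem -/

section Discrete

variable {X : Type*} {n : ℕ}

/-- The edge weights `θ(m + ε)`; the floor `ε` makes them positive. -/
def liftedMobility (ε : ℝ) (m : X → ℝ) : X → X → ℝ := mobility fun x => m x + ε

lemma liftedMobility_pos {ε : ℝ} (hε : 0 < ε) {m : X → ℝ} (hm : ∀ x, 0 ≤ m x) (x y : X) :
    0 < liftedMobility ε m x y :=
  mobility_pos (fun x => add_pos_of_nonneg_of_pos (hm x) hε) x y

/-- The node values of a discrete curve, indexed by natural numbers; indices beyond `n`
are reduced modulo `n + 1` and carry no meaning. -/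
def node (φ : Fin (n + 1) → X → ℝ) (k : ℕ) : X → ℝ := φ (Fin.ofNat (n + 1) k)

lemma node_of_le (η : ℕ → X → ℝ) {k : ℕ} (hk : k ≤ n) :
    node (n := n) (fun i => η i) k = η k := by
  simp [node, Nat.mod_eq_of_lt (Nat.lt_succ_of_le hk)]

/-- The cone of pairs of nonnegative multipliers. -/
def multipliers (X : Type*) : Set ((ℕ → X → ℝ) × (ℕ → X → ℝ)) :=
  {y | (∀ k x, 0 ≤ y.1 k x) ∧ ∀ k x, 0 ≤ y.2 k x}

end Discrete

namespace RevChain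

variable {X : Type*} [Fintype X] (C : RevChain X)

lemma energy_liftedMobility_concave {ε : ℝ} (hε : 0 < ε) {m m' : X → ℝ} (hm : ∀ x, 0 ≤ m x)
    (hm' : ∀ x, 0 ≤ m' x) {s t : ℝ} (hs : 0 ≤ s) (ht : 0 ≤ t) (hst : s + t = 1) (φ : X → ℝ) :
    s * C.energy (liftedMobility ε m) φ φ + t * C.energy (liftedMobility ε m') φ φ
      ≤ C.energy (liftedMobility ε (s • m + t • m')) φ φ := by
  rw [← energy_weight_smul, ← energy_weight_smul, ← energy_weight_add]
  refine C.energy_mono (fun x y => ?_) φ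
  refine (mobility_concave hs ht (fun x => add_nonneg (hm x) hε.le)
    (fun x => add_nonneg (hm' x) hε.le) x y).trans (le_of_eq ?_)
  unfold liftedMobility
  congr 1
  funext z
  simp only [Pi.add_apply, Pi.smul_apply, smul_eq_mul]
  linear_combination ε * hst

/-- The contribution of the `k`-th of `n` time cells to the quadratic part of the discrete
Lagrangian. The multipliers `m k` and `m' k` belong to the Hamilton–Jacobi inequality at the left
and at the right end of the cell. -/
def cellForm (a b : ℝ) (p : X → ℝ) (n : ℕ) (ε : ℝ) (m m' φ η : ℕ → X → ℝ) (k : ℕ) : ℝ :=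
  (n : ℝ)⁻¹ * (1 / (2 * a ^ 2) * (C.pairing (φ k) p * C.pairing (η k) p
      + C.pairing (φ (k + 1)) p * C.pairing (η (k + 1)) p)
    + 1 / b ^ 2 * (C.energy (liftedMobility ε (m k)) (φ k) (η k)
      + C.energy (liftedMobility ε (m' k)) (φ (k + 1)) (η (k + 1))))

/-- The linear part of the discrete Lagrangian: the boundary terms of the dual functional and the
multipliers paired with the increments of the nodes. -/
def linPart (μ₀ μ₁ : X → ℝ) (n : ℕ) (m m' η : ℕ → X → ℝ) : ℝ :=
  C.pairing (η n) μ₁ - C.pairing (η 0) μ₀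
    - ∑ k ∈ Finset.range n, C.pairing (η (k + 1) - η k) (m k + m' k)

section

variable {a b : ℝ} {p : X → ℝ} {n : ℕ} {ε : ℝ} {m m' : ℕ → X → ℝ}

lemma cellForm_diag (φ : ℕ → X → ℝ) (k : ℕ) : C.cellForm a b p n ε m m' φ φ k
    = (n : ℝ)⁻¹ * (1 / (2 * a ^ 2) * (C.pairing (φ k) p ^ 2 + C.pairing (φ (k + 1)) p ^ 2)
    + 1 / b ^ 2 * (C.energy (liftedMobility ε (m k)) (φ k) (φ k)
      + C.energy (liftedMobility ε (m' k)) (φ (k + 1)) (φ (k + 1)))) := by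
  simp only [cellForm, sq]

lemma cellForm_nonneg (hε : 0 < ε) (hm : ∀ k x, 0 ≤ m k x) (hm' : ∀ k x, 0 ≤ m' k x)
    (φ : ℕ → X → ℝ) (k : ℕ) : 0 ≤ C.cellForm a b p n ε m m' φ φ k := by
  have h1 := C.energy_nonneg (fun x y => (liftedMobility_pos hε (hm k) x y).le) (φ k)
  have h2 := C.energy_nonneg (fun x y => (liftedMobility_pos hε (hm' k) x y).le) (φ (k + 1))
  rw [cellForm_diag]
  positivity

/-- Zero energy makes a node constant, and zero pairing with `p` makes the constant vanish. This is
where the floor `ε` is needed. -/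
lemma eq_zero_of_cellForm_eq_zero (ha : 0 < a) (hb : 0 < b) (hp : C.pairing 1 p = 1)
    (hn : 0 < n) (hε : 0 < ε) (hm : ∀ k x, 0 ≤ m k x) (hm' : ∀ k x, 0 ≤ m' k x)
    {φ : ℕ → X → ℝ} {k : ℕ} (h : C.cellForm a b p n ε m m' φ φ k = 0) :
    φ k = 0 ∧ φ (k + 1) = 0 := by
  have hw := liftedMobility_pos hε (hm k)
  have hw' := liftedMobility_pos hε (hm' k)
  have h1 := C.energy_nonneg (fun x y => (hw x y).le) (φ k)
  have h2 := C.energy_nonneg (fun x y => (hw' x y).le) (φ (k + 1))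
  have hn' : (n : ℝ)⁻¹ ≠ 0 := by positivity
  have hA : 0 < 1 / (2 * a ^ 2) := by positivity
  have hB : 0 < 1 / b ^ 2 := by positivity
  rw [cellForm_diag, mul_eq_zero, or_iff_right hn'] at h
  have e1 : 1 / (2 * a ^ 2) * (C.pairing (φ k) p ^ 2 + C.pairing (φ (k + 1)) p ^ 2) = 0 :=
    le_antisymm (by have : 0 ≤ 1 / b ^ 2 * (C.energy (liftedMobility ε (m k)) (φ k) (φ k)
      + C.energy (liftedMobility ε (m' k)) (φ (k + 1)) (φ (k + 1))) := by positivity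
                    linarith) (by positivity)
  have e2 := h
  rw [e1, zero_add, mul_eq_zero, or_iff_right hB.ne'] at e2
  rw [mul_eq_zero, or_iff_right hA.ne'] at e1
  have hs1 := sq_nonneg (C.pairing (φ k) p)
  have hs2 := sq_nonneg (C.pairing (φ (k + 1)) p)
  have hp' : C.pairing 1 p ≠ 0 := by rw [hp]; exact one_ne_zero
  exact ⟨C.eq_zero_of_energy_eq_zero hw hp' (by linarith) (pow_eq_zero_iff two_ne_zero |>.1
      (by linarith)), C.eq_zero_of_energy_eq_zero hw' hp' (by linarith)
      (pow_eq_zero_iff two_ne_zero |>.1 (by linarith))⟩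

variable (a b p n ε m m') in
/-- The quadratic part of the discrete Lagrangian as a bilinear form. -/
def quadForm : (Fin (n + 1) → X → ℝ) →ₗ[ℝ] (Fin (n + 1) → X → ℝ) →ₗ[ℝ] ℝ :=
  LinearMap.mk₂ ℝ (fun φ η => ∑ k ∈ Finset.range n,
      C.cellForm a b p n ε m m' (node φ) (node η) k)
    (fun φ φ' η => by
      simp only [cellForm, node, Pi.add_apply, pairing_add_left, energy_add_left,
        ← Finset.sum_add_distrib]
      exact Finset.sum_congr rfl fun k _ => by ring)
    (fun c φ η => by
      simp only [cellForm, node, Pi.smul_apply, pairing_smul_left, energy_smul_left,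
        smul_eq_mul, Finset.mul_sum]
      exact Finset.sum_congr rfl fun k _ => by ring)
    (fun φ η η' => by
      simp only [cellForm, node, Pi.add_apply, pairing_add_left, energy_add_right,
        ← Finset.sum_add_distrib]
      exact Finset.sum_congr rfl fun k _ => by ring)
    (fun c φ η => by
      simp only [cellForm, node, Pi.smul_apply, pairing_smul_left, energy_smul_right,
        smul_eq_mul, Finset.mul_sum]
      exact Finset.sum_congr rfl fun k _ => by ring)

lemma quadForm_apply (φ η : Fin (n + 1) → X → ℝ) : C.quadForm a b p n ε m m' φ η
    = ∑ k ∈ Finset.range n, C.cellForm a b p n ε m m' (node φ) (node η) k := rfl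

lemma quadForm_symm (φ η : Fin (n + 1) → X → ℝ) :
    C.quadForm a b p n ε m m' φ η = C.quadForm a b p n ε m m' η φ := by
  simp only [quadForm_apply, cellForm]
  refine Finset.sum_congr rfl fun k _ => ?_
  rw [C.energy_comm _ (node φ k), C.energy_comm _ (node φ (k + 1))]
  ring

lemma quadForm_pos (ha : 0 < a) (hb : 0 < b) (hp : C.pairing 1 p = 1) (hn : 0 < n)
    (hε : 0 < ε) (hm : ∀ k x, 0 ≤ m k x) (hm' : ∀ k x, 0 ≤ m' k x)
    (φ : Fin (n + 1) → X → ℝ) (hφ : φ ≠ 0) : 0 < C.quadForm a b p n ε m m' φ φ := by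
  have hnn : ∀ k ∈ Finset.range n, 0 ≤ C.cellForm a b p n ε m m' (node φ) (node φ) k :=
    fun k _ => C.cellForm_nonneg hε hm hm' _ k
  refine (Finset.sum_nonneg hnn).lt_of_ne fun h0 => hφ ?_
  have h0 := (Finset.sum_eq_zero_iff_of_nonneg hnn).1 h0.symm
  funext i
  have hi : φ i = node φ i := by simp [node]
  rw [hi]
  rcases (Nat.lt_succ_iff.1 i.2).lt_or_eq with h | h
  · exact (C.eq_zero_of_cellForm_eq_zero ha hb hp hn hε hm hm'
      (h0 i (Finset.mem_range.2 h))).1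
  · have := (C.eq_zero_of_cellForm_eq_zero ha hb hp hn hε hm hm'
      (h0 (n - 1) (Finset.mem_range.2 (by omega)))).2
    rw [Nat.sub_add_cancel hn] at this
    rw [h]
    exact this

variable (n m m') in
/-- The linear part of the discrete Lagrangian as a linear form. -/
def linForm (μ₀ μ₁ : X → ℝ) : (Fin (n + 1) → X → ℝ) →ₗ[ℝ] ℝ where
  toFun η := C.linPart μ₀ μ₁ n m m' (node η)
  map_add' η η' := by
    simp only [linPart, node, Pi.add_apply, pairing_add_left, pairing_sub_left,
      Finset.sum_add_distrib, Finset.sum_sub_distrib]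
    ring
  map_smul' c η := by
    simp only [linPart, node, Pi.smul_apply, pairing_smul_left, pairing_sub_left,
      Finset.sum_sub_distrib, ← Finset.mul_sum, smul_eq_mul, RingHom.id_apply]
    ring

end

variable {a b : ℝ} {p : X → ℝ}

/-- The discrete Lagrangian, as a function of the node values and of the pair of multipliers. -/
def lagrangian (a b : ℝ) (p μ₀ μ₁ : X → ℝ) (n : ℕ) (ε : ℝ) (φ : Fin (n + 1) → X → ℝ)
    (y : (ℕ → X → ℝ) × (ℕ → X → ℝ)) : ℝ :=
  C.linForm n y.1 y.2 μ₀ μ₁ φ - 1 / 2 * C.quadForm a b p n ε y.1 y.2 φ φ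

/-- Concavity of the mobility makes the Lagrangian convex in the multipliers. -/
lemma convexOn_lagrangian (μ₀ μ₁ : X → ℝ) (n : ℕ) {ε : ℝ} (hε : 0 < ε)
    (φ : Fin (n + 1) → X → ℝ) :
    ConvexOn ℝ (multipliers X) (C.lagrangian a b p μ₀ μ₁ n ε φ) := by
  refine ⟨?_, ?_⟩
  · rintro y ⟨hy, hy'⟩ z ⟨hz, hz'⟩ s t hs ht -
    exact ⟨fun k x => add_nonneg (mul_nonneg hs (hy k x)) (mul_nonneg ht (hz k x)),
      fun k x => add_nonneg (mul_nonneg hs (hy' k x)) (mul_nonneg ht (hz' k x))⟩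
  · rintro ⟨y, y'⟩ ⟨hy, hy'⟩ ⟨z, z'⟩ ⟨hz, hz'⟩ s t hs ht hst
    have hlin : C.linForm n (s • y + t • z) (s • y' + t • z') μ₀ μ₁ φ
        = s * C.linForm n y y' μ₀ μ₁ φ + t * C.linForm n z z' μ₀ μ₁ φ := by
      change C.linPart _ _ _ _ _ _ = s * C.linPart _ _ _ _ _ _ + t * C.linPart _ _ _ _ _ _
      simp only [linPart, Pi.add_apply, Pi.smul_apply, pairing_add_right, pairing_smul_right,
        Finset.sum_add_distrib, ← Finset.mul_sum]
      obtain rfl : t = 1 - s := by linarith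
      ring
    have hquad : s * C.quadForm a b p n ε y y' φ φ + t * C.quadForm a b p n ε z z' φ φ
        ≤ C.quadForm a b p n ε (s • y + t • z) (s • y' + t • z') φ φ := by
      simp only [quadForm_apply, cellForm_diag, Finset.mul_sum, ← Finset.sum_add_distrib]
      refine Finset.sum_le_sum fun k _ => ?_
      have h1 := C.energy_liftedMobility_concave hε (hy k) (hz k) hs ht hst (node φ k)
      have h2 := C.energy_liftedMobility_concave hε (hy' k) (hz' k) hs ht hst (node φ (k + 1))
      have hb : 0 ≤ 1 / b ^ 2 := by positivity
      have hn : 0 ≤ (n : ℝ)⁻¹ := by positivity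
      simp only [Pi.add_apply, Pi.smul_apply]
      have h3 := mul_le_mul_of_nonneg_left (mul_le_mul_of_nonneg_left (add_le_add h1 h2) hb) hn
      obtain rfl : t = 1 - s := by linarith
      linarith
    simp only [lagrangian, Prod.smul_mk, Prod.mk_add_mk, smul_eq_mul, hlin]
    linarith

/-- If the discrete Hamilton–Jacobi inequality fails in some cell, the multiplier concentrated
there drives the Lagrangian to `-∞`. -/
lemma exists_lagrangian_lt_of_violation (μ₀ μ₁ : X → ℝ) {n : ℕ} {ε : ℝ} (hε : 0 < ε)
    (φ : Fin (n + 1) → X → ℝ) {k : ℕ} (hk : k < n) {μ : X → ℝ} (hμ : ∀ x, 0 ≤ μ x) {j : ℕ}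
    (hj : j ∈ ({k, k + 1} : Set ℕ))
    (h : 0 < C.pairing (node φ (k + 1) - node φ k) μ
      + (n : ℝ)⁻¹ * (1 / (2 * b ^ 2)) * C.energy (mobility μ) (node φ j) (node φ j)) (c : ℝ) :
    ∃ y ∈ multipliers X, C.lagrangian a b p μ₀ μ₁ n ε φ y < c := by
  set δ := C.pairing (node φ (k + 1) - node φ k) μ
      + (n : ℝ)⁻¹ * (1 / (2 * b ^ 2)) * C.energy (mobility μ) (node φ j) (node φ j) with hδ
  set J := C.pairing (node φ n) μ₁ - C.pairing (node φ 0) μ₀ with hJ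
  -- `l` is so large that `J - l δ < c`.
  set l : ℝ := (|J - c| + 1) / δ with hl
  have hl0 : 0 ≤ l := by positivity
  have hlδ : l * δ = |J - c| + 1 := div_mul_cancel₀ _ h.ne'
  set M : ℕ → X → ℝ := Pi.single k (l • μ) with hM
  have hMk : M k = l • μ := by simp [hM]
  have hM0 : ∀ i x, 0 ≤ M i x := by
    intro i x
    rcases eq_or_ne i k with rfl | hik
    · rw [hMk]; exact mul_nonneg hl0 (hμ x)
    · simp [hM, hik]
  have hz : ∀ (i : ℕ) (x : X), 0 ≤ (0 : ℕ → X → ℝ) i x := fun _ _ => le_rfl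
  have hsum : ∑ i ∈ Finset.range n, C.pairing (node φ (i + 1) - node φ i) (M i)
      = l * C.pairing (node φ (k + 1) - node φ k) μ := by
    rw [Finset.sum_eq_single_of_mem k (Finset.mem_range.2 hk), hMk, pairing_smul_right]
    intro i _ hik
    simp [hM, hik, pairing]
  -- By homogeneity the mobility of `l μ` is `l` times that of `μ`, and the floor increases it.
  have hen : l * C.energy (mobility μ) (node φ j) (node φ j)
      ≤ C.energy (liftedMobility ε (M k)) (node φ j) (node φ j) := by
    rw [← energy_weight_smul]
    refine C.energy_mono (fun x y => ?_) _
    rw [Pi.smul_apply, Pi.smul_apply, smul_eq_mul, ← mobility_smul hl0 hμ, hMk]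
    exact mobility_mono (fun x => mul_nonneg hl0 (hμ x)) (fun x => by simp [hε.le]) x y
  have hn0 : 0 ≤ (n : ℝ)⁻¹ := by positivity
  have hb0 : 0 ≤ 1 / b ^ 2 := by positivity
  have hfin : ∀ Q : ℝ, (n : ℝ)⁻¹ * (1 / b ^ 2 *
      C.energy (liftedMobility ε (M k)) (node φ j) (node φ j)) ≤ Q →
      J - l * C.pairing (node φ (k + 1) - node φ k) μ - 1 / 2 * Q < c := by
    intro Q hQ
    have h1 := mul_le_mul_of_nonneg_left (mul_le_mul_of_nonneg_left hen hb0) hn0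
    have h2 : l * δ = l * C.pairing (node φ (k + 1) - node φ k) μ + 1 / 2 *
        ((n : ℝ)⁻¹ * (1 / b ^ 2 * (l * C.energy (mobility μ) (node φ j) (node φ j)))) := by
      rw [hδ]; ring
    have h3 := le_abs_self (J - c)
    linarith
  rcases hj with rfl | hj
  · refine ⟨(M, 0), ⟨hM0, hz⟩, ?_⟩
    have hlin : C.linForm n M 0 μ₀ μ₁ φ
        = J - l * C.pairing (node φ (j + 1) - node φ j) μ := by
      change C.linPart _ _ _ _ _ _ = _
      simp only [linPart, Pi.zero_apply, add_zero, hsum, hJ]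
    simp only [lagrangian]
    rw [hlin]
    refine hfin _ (le_trans ?_ (Finset.single_le_sum
      (fun i _ => C.cellForm_nonneg hε hM0 hz (node φ) i) (Finset.mem_range.2 hk)))
    have h2 := C.energy_nonneg
      (fun x y => (liftedMobility_pos hε (hz j) x y).le) (node φ (j + 1))
    rw [cellForm_diag]
    refine mul_le_mul_of_nonneg_left ?_ hn0
    have h3 : 0 ≤ 1 / (2 * a ^ 2) * (C.pairing (node φ j) p ^ 2
      + C.pairing (node φ (j + 1)) p ^ 2) := by positivity
    have h4 := mul_nonneg hb0 h2
    linarith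
  · have hj : j = k + 1 := hj
    subst hj
    refine ⟨(0, M), ⟨hz, hM0⟩, ?_⟩
    have hlin : C.linForm n 0 M μ₀ μ₁ φ
        = J - l * C.pairing (node φ (k + 1) - node φ k) μ := by
      change C.linPart _ _ _ _ _ _ = _
      simp only [linPart, Pi.zero_apply, zero_add, hsum, hJ]
    simp only [lagrangian]
    rw [hlin]
    refine hfin _ (le_trans ?_ (Finset.single_le_sum
      (fun i _ => C.cellForm_nonneg hε hz hM0 (node φ) i) (Finset.mem_range.2 hk)))
    have h2 := C.energy_nonneg (fun x y => (liftedMobility_pos hε (hz k) x y).le) (node φ k)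
    rw [cellForm_diag]
    refine mul_le_mul_of_nonneg_left ?_ hn0
    have h3 : 0 ≤ 1 / (2 * a ^ 2) * (C.pairing (node φ k) p ^ 2
      + C.pairing (node φ (k + 1)) p ^ 2) := by positivity
    have h4 := mul_nonneg hb0 h2
    linarith

/-- The minimax principle applied to the discrete Lagrangian: if the dual values of all `C¹`
subsolutions are at most `D < c`, there are multipliers and a stationary point of the Lagrangian
whose quadratic part is at most `2c`. -/
lemma exists_discrete_saddle (ha : 0 < a) (hb : 0 < b) (hp : C.pairing 1 p = 1)
    (μ₀ μ₁ : X → ℝ) {D c : ℝ} (hDc : D < c)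
    (hD : ∀ Ψ, IsC1 1 Ψ → C.SatisfiesHJ 1 b Ψ → C.dualValue a p μ₀ μ₁ Ψ ≤ D)
    {n : ℕ} (hn : 0 < n) {ε : ℝ} (hε : 0 < ε) :
    ∃ φ m m' : ℕ → X → ℝ, (∀ k x, 0 ≤ m k x) ∧ (∀ k x, 0 ≤ m' k x) ∧
      (∀ η, C.linPart μ₀ μ₁ n m m' η
        = ∑ k ∈ Finset.range n, C.cellForm a b p n ε m m' φ η k) ∧
      ∑ k ∈ Finset.range n, C.cellForm a b p n ε m m' φ φ k ≤ 2 * c := by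
  have h0 : (0 : (ℕ → X → ℝ) × (ℕ → X → ℝ)) ∈ multipliers X :=
    ⟨fun _ _ => le_rfl, fun _ _ => le_rfl⟩
  have hpos : ∀ y ∈ multipliers X, ∀ φ, φ ≠ 0 → 0 < C.quadForm a b p n ε y.1 y.2 φ φ :=
    fun y hy => C.quadForm_pos ha hb hp hn hε hy.1 hy.2
  have hnn : ∀ y ∈ multipliers X, ∀ φ, 0 ≤ C.quadForm a b p n ε y.1 y.2 φ φ :=
    fun y hy φ => by
      rw [quadForm_apply]
      exact Finset.sum_nonneg fun k _ => C.cellForm_nonneg hε hy.1 hy.2 _ k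
  obtain ⟨y, hy, hyc⟩ := exists_forall_le_of_forall_exists_lt (Y := multipliers X)
    (K := C.lagrangian a b p μ₀ μ₁ n ε) (c := c)
    (C.convexOn_lagrangian (a := a) (b := b) (p := p) μ₀ μ₁ n hε 0).1
    (fun y hy => concaveOn_sub_quadratic _ (C.quadForm_symm) (hnn y hy) _)
    (fun y _ => (LinearMap.continuous_of_finiteDimensional _).sub
      (continuous_const.mul (continuous_linearMap_diag _)))
    (fun φ => C.convexOn_lagrangian μ₀ μ₁ n hε φ) h0
    (isCompact_superlevel_quadratic _ (hpos 0 h0) _ c) fun φ => by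
      by_cases hfeas : ∀ k < n, ∀ j ∈ ({k, k + 1} : Set ℕ), ∀ μ : X → ℝ, (∀ x, 0 ≤ μ x) →
          C.pairing (node φ (k + 1) - node φ k) μ + (n : ℝ)⁻¹ * (1 / (2 * b ^ 2))
            * C.energy (mobility μ) (node φ j) (node φ j) ≤ 0
      -- For feasible nodes the multiplier `0` works: the Lagrangian is then at most the discrete
      -- dual value; if that exceeded `D`, so would the dual value of some `C¹` subsolution.
      · refine ⟨0, h0, ?_⟩
        refine lt_of_le_of_lt ?_ hDc
        by_contra! hlt
        have hlin : C.linForm n 0 0 μ₀ μ₁ φ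
            = C.pairing (node φ n) μ₁ - C.pairing (node φ 0) μ₀ := by
          change C.linPart _ _ _ _ _ _ = _
          simp [linPart, pairing]
        have hquad : 1 / a ^ 2 * ∑ k ∈ Finset.range n, (n : ℝ)⁻¹ / 2
            * (C.pairing (node φ k) p ^ 2 + C.pairing (node φ (k + 1)) p ^ 2)
            ≤ C.quadForm a b p n ε 0 0 φ φ := by
          rw [quadForm_apply, Finset.mul_sum]
          refine Finset.sum_le_sum fun k _ => ?_
          have h1 := C.energy_nonneg
            (fun x y => (liftedMobility_pos hε (h0.1 k) x y).le) (node φ k)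
          have h2 := C.energy_nonneg
            (fun x y => (liftedMobility_pos hε (h0.2 k) x y).le) (node φ (k + 1))
          have h3 : 0 ≤ (n : ℝ)⁻¹ * (1 / b ^ 2
            * (C.energy (liftedMobility ε ((0 : ℕ → X → ℝ) k)) (node φ k) (node φ k)
            + C.energy (liftedMobility ε ((0 : ℕ → X → ℝ) k)) (node φ (k + 1))
              (node φ (k + 1)))) := mul_nonneg (by positivity)
                (mul_nonneg (by positivity) (add_nonneg h1 h2))
          rw [cellForm_diag, mul_add (n : ℝ)⁻¹]
          refine le_trans (le_of_eq ?_) (le_add_of_nonneg_right h3)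
          field_simp
        have e : 1 / (2 * a ^ 2) = 1 / 2 * (1 / a ^ 2) := by field_simp
        have hlag : C.lagrangian a b p μ₀ μ₁ n ε φ 0 ≤ C.pairing (node φ n) μ₁
            - C.pairing (node φ 0) μ₀ - 1 / (2 * a ^ 2) * ∑ k ∈ Finset.range n, (n : ℝ)⁻¹ / 2
              * (C.pairing (node φ k) p ^ 2 + C.pairing (node φ (k + 1)) p ^ 2) := by
          simp only [lagrangian, Prod.fst_zero, Prod.snd_zero]
          rw [hlin, e, mul_assoc]
          linarith
        obtain ⟨Ψ, hΨ, hHJ, hΨD⟩ := C.exists_isC1_dualValue_gt (a := a) hn p μ₀ μ₁ hfeas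
          (hlt.trans_le hlag)
        exact absurd (hD Ψ hΨ hHJ) (not_le.2 hΨD)
      · push Not at hfeas
        obtain ⟨k, hk, j, hj, μ, hμ, hviol⟩ := hfeas
        exact C.exists_lagrangian_lt_of_violation μ₀ μ₁ hε φ hk hμ hj hviol c
  obtain ⟨φ, hφ, hφc⟩ := exists_stationary_quadratic _ (hpos y hy) _ hyc
  refine ⟨node φ, y.1, y.2, hy.1, hy.2, fun η => ?_, hφc⟩
  have h := hφ fun i => η i
  have e1 : C.linForm n y.1 y.2 μ₀ μ₁ (fun i => η i) = C.linPart μ₀ μ₁ n y.1 y.2 η := by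
    change C.linPart _ _ _ _ _ _ = _
    unfold linPart
    rw [node_of_le η le_rfl, node_of_le η (Nat.zero_le _)]
    congr 1
    refine Finset.sum_congr rfl fun k hk => ?_
    have hk := Finset.mem_range.1 hk
    rw [node_of_le η hk, node_of_le η hk.le]
  rw [← e1, h, quadForm_apply]
  refine Finset.sum_congr rfl fun k hk => ?_
  have hk := Finset.mem_range.1 hk
  simp only [cellForm]
  rw [node_of_le η hk, node_of_le η hk.le]

end RevChain

namespace RevChain

variable {X : Type*} [Fintype X] (C : RevChain X) {a b : ℝ} {p : X → ℝ}

/-! ### From the discrete saddle point to an admissible curve -/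

/-- The increment of density produced over half a time cell of length `τ` by the potential `φ`
with edge weights `w`. -/
def halfStep (a b : ℝ) (p : X → ℝ) (τ : ℝ) (w : X → X → ℝ) (φ : X → ℝ) : X → ℝ :=
  τ • ((1 / (2 * a ^ 2) * C.pairing φ p) • p - (1 / b ^ 2) • C.flow w φ)

/-- The half steps represent the derivative of the quadratic part of the Lagrangian. -/
lemma pairing_halfStep (η : X → ℝ) (τ : ℝ) (w : X → X → ℝ) (φ : X → ℝ) :
    C.pairing η (C.halfStep a b p τ w φ)
      = τ * (1 / (2 * a ^ 2) * C.pairing φ p * C.pairing η p + 1 / b ^ 2 * C.energy w φ η) := by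
  rw [halfStep, pairing_smul_right, pairing_sub_right, pairing_smul_right, pairing_smul_right,
    pairing_flow]
  ring

/-- The half steps are of order `√τ`, with a constant that depends only on the bounds on the
action and on the weights. -/
lemma abs_halfStep_le (ha : 0 < a) (hb : 0 < b) {τ Γ W P r ε : ℝ} (hτ : 0 ≤ τ) (hr : 0 < r)
    (hrϖ : ∀ x, r ≤ C.ϖ x) (hp : ∀ x, 0 ≤ p x) (hP : ∀ x, p x ≤ P) (hε : 0 ≤ ε)
    {w : X → X → ℝ} (hw : ∀ x y, 0 ≤ w x y) (hW : ∀ x y, w x y ≤ W) {φ : X → ℝ}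
    (h1 : τ * (1 / (2 * a ^ 2) * C.pairing φ p ^ 2) ≤ Γ)
    (h2 : τ * (1 / b ^ 2 * C.energy w φ φ) ≤ Γ)
    (hsmall : τ * (Γ * P ^ 2 / a ^ 2 + 2 * Γ * W / (r ^ 2 * b ^ 2)) ≤ ε ^ 2) (x : X) :
    |C.halfStep a b p τ w φ x| ≤ ε := by
  have hW0 : 0 ≤ W := (hw x x).trans (hW x x)
  have hΓ : 0 ≤ Γ := le_trans (by positivity) h1
  refine abs_le_of_sq_le_sq ?_ hε
  refine le_trans ?_ hsmall
  set u := C.pairing φ p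
  set f := C.flow w φ x
  set e := C.energy w φ φ
  have hf : f ^ 2 * r ^ 2 ≤ e * W := by
    have h := C.flow_apply_sq_le hw hW φ x
    rw [mul_pow] at h
    have : r ^ 2 ≤ C.ϖ x ^ 2 := by
      have := hrϖ x
      gcongr
    nlinarith [sq_nonneg f]
  have hval : C.halfStep a b p τ w φ x = τ * (1 / (2 * a ^ 2) * u * p x - 1 / b ^ 2 * f) := by
    simp [halfStep, u, f]
  have hA : (τ * (1 / (2 * a ^ 2) * u * p x)) ^ 2 ≤ τ * (Γ * P ^ 2 / (2 * a ^ 2)) := by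
    have hpP : p x ^ 2 ≤ P ^ 2 := by
      have := hP x
      have := hp x
      gcongr
    calc (τ * (1 / (2 * a ^ 2) * u * p x)) ^ 2
        = τ / (2 * a ^ 2) * (τ * (1 / (2 * a ^ 2) * u ^ 2)) * p x ^ 2 := by ring
      _ ≤ τ / (2 * a ^ 2) * Γ * P ^ 2 := by gcongr
      _ = _ := by ring
  have hB : (τ * (1 / b ^ 2 * f)) ^ 2 ≤ τ * (Γ * W / (r ^ 2 * b ^ 2)) := by
    calc (τ * (1 / b ^ 2 * f)) ^ 2
        = τ ^ 2 / (b ^ 2 * b ^ 2 * r ^ 2) * (f ^ 2 * r ^ 2) := by field_simp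
      _ ≤ τ ^ 2 / (b ^ 2 * b ^ 2 * r ^ 2) * (e * W) := by gcongr
      _ = τ * W / (b ^ 2 * r ^ 2) * (τ * (1 / b ^ 2 * e)) := by field_simp
      _ ≤ τ * W / (b ^ 2 * r ^ 2) * Γ := by gcongr
      _ = _ := by field_simp
  rw [hval]
  have hsq := sq_nonneg (τ * (1 / (2 * a ^ 2) * u * p x) + τ * (1 / b ^ 2 * f))
  have e1 : τ * (Γ * P ^ 2 / a ^ 2 + 2 * Γ * W / (r ^ 2 * b ^ 2))
      = 2 * (τ * (Γ * P ^ 2 / (2 * a ^ 2))) + 2 * (τ * (Γ * W / (r ^ 2 * b ^ 2))) := by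
    field_simp
  rw [e1]
  nlinarith

/-- The discrete curve started at `μ₀`, following the two half steps in each cell. -/
def discreteCurve (μ₀ : X → ℝ) (A B : ℕ → X → ℝ) : ℕ → X → ℝ
  | 0 => μ₀
  | k + 1 => discreteCurve μ₀ A B k + A k + B k

/-- Stationarity of the discrete Lagrangian, after summation by parts: the curve ends at `μ₁`, and
the total multiplier of each cell is the value of the curve in the middle of the cell. -/
lemma discreteCurve_of_stationary {μ₀ μ₁ : X → ℝ} {n : ℕ} {m m' A B : ℕ → X → ℝ}
    (h : ∀ η, C.linPart μ₀ μ₁ n m m' η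
      = ∑ k ∈ Finset.range n, (C.pairing (η k) (A k) + C.pairing (η (k + 1)) (B k))) :
    discreteCurve μ₀ A B n = μ₁ ∧ ∀ k < n, m k + m' k = discreteCurve μ₀ A B k + A k := by
  set ν := discreteCurve μ₀ A B with hν
  -- Summation by parts.
  have key : ∀ η : ℕ → X → ℝ, C.pairing (η n) (μ₁ - ν n)
      = ∑ k ∈ Finset.range n, C.pairing (η (k + 1) - η k) (m k + m' k - ν k - A k) := by
    intro η
    have h1 := Finset.sum_range_sub (fun k => C.pairing (η k) (ν k)) n
    have h2 : ∀ k, C.pairing (η (k + 1)) (ν (k + 1)) - C.pairing (η k) (ν k)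
        = C.pairing (η (k + 1) - η k) (ν k + A k)
          + (C.pairing (η k) (A k) + C.pairing (η (k + 1)) (B k)) := by
      intro k
      have : ν (k + 1) = ν k + A k + B k := rfl
      rw [this]
      simp only [pairing_add_right, pairing_sub_left]
      ring
    have h0 : ν 0 = μ₀ := rfl
    simp only [h2, Finset.sum_add_distrib, h0] at h1
    have h3 := h η
    simp only [linPart, Finset.sum_add_distrib] at h3
    have h4 : ∀ k, C.pairing (η (k + 1) - η k) (m k + m' k - ν k - A k)
        = C.pairing (η (k + 1) - η k) (m k + m' k)
          - C.pairing (η (k + 1) - η k) (ν k + A k) := by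
      intro k
      simp only [pairing_add_right, pairing_sub_right]
      ring
    simp only [h4, Finset.sum_sub_distrib, pairing_sub_right]
    linarith
  -- Test with constant node functions.
  have hend : ν n = μ₁ := by
    refine (C.pairing_ext fun ζ => ?_).symm
    have := key fun _ => ζ
    rw [pairing_sub_right] at this
    simp only [sub_self] at this
    simp only [pairing, Pi.zero_apply, zero_mul, Finset.sum_const_zero] at this ⊢
    linarith
  refine ⟨hend, fun k hk => ?_⟩
  refine C.pairing_ext fun ζ => ?_
  -- Test with the node function that jumps from `0` to `ζ` between the nodes `k` and `k + 1`.
  have h1 := key fun j => if k < j then ζ else 0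
  rw [hend, sub_self] at h1
  rw [Finset.sum_eq_single_of_mem k (Finset.mem_range.2 hk)] at h1
  · simp only [lt_irrefl, if_false, Nat.lt_succ_self, if_true, sub_zero, pairing_sub_right] at h1
    have h0 : ∀ q : X → ℝ, C.pairing q 0 = 0 := fun q => by simp [pairing]
    rw [h0] at h1
    rw [C.pairing_add_right ζ (ν k)]
    linarith
  · intro j _ hjk
    have : (if k < j + 1 then ζ else 0) - (if k < j then ζ else 0) = 0 := by
      rcases lt_or_gt_of_ne hjk with h' | h'
      · rw [if_neg (by omega), if_neg (by omega), sub_zero]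
      · rw [if_pos (by omega), if_pos h', sub_self]
    rw [this]
    simp [pairing]

variable {C} in
lemma Joins.mono {T A A' : ℝ} {α β : X → ℝ} (h : C.Joins a b p T α β A) (hA : A ≤ A') :
    C.Joins a b p T α β A' := by
  obtain ⟨g, ψ, h, h1, h2, h3, h4, h5, h6, h7⟩ := h
  exact ⟨g, ψ, h, h1, h2, h3, h4, h5, h6, h7.trans (ENNReal.ofReal_le_ofReal hA)⟩

/-- One cell of the lifted discrete curve, run through in time `lam / n`. The lift `q p` absorbs the
half steps and the floor `ε`, so that the segment lies above `(m + ε) + (m' + ε)`. Its mobility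
then dominates the sum of the weights used in the two half steps, and the transport along the
segment costs no more than the two half steps together. -/
lemma joins_cell (ha : 0 < a) (hb : 0 < b) {n : ℕ} (hn : 0 < n)
    {ε q lam : ℝ} (hε : 0 < ε) (hlam : 0 < lam) (hq : ∀ x, 3 * ε ≤ q * p x)
    {m m' φ : ℕ → X → ℝ} (hm : ∀ k x, 0 ≤ m k x) (hm' : ∀ k x, 0 ≤ m' k x) {k : ℕ}
    {A B ν ν' : X → ℝ}
    (hA : A = C.halfStep a b p (n : ℝ)⁻¹ (liftedMobility ε (m k)) (φ k))
    (hB : B = C.halfStep a b p (n : ℝ)⁻¹ (liftedMobility ε (m' k)) (φ (k + 1)))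
    (hν : m k + m' k = ν + A) (hν' : ν' = ν + A + B) (hAε : ∀ x, |A x| ≤ ε)
    (hBε : ∀ x, |B x| ≤ ε) :
    C.Joins a b p (lam / n) (ν + q • p) (ν' + q • p)
      (C.cellForm a b p n ε m m' φ φ k / lam) := by
  have hn' : (0 : ℝ) < n := by exact_mod_cast hn
  set τ := (n : ℝ)⁻¹ with hτ
  have hτ0 : 0 < τ := by positivity
  set w := liftedMobility ε (m k) with hw
  set w' := liftedMobility ε (m' k) with hw'
  have hw0 : ∀ x y, 0 ≤ w x y := fun x y => (liftedMobility_pos hε (hm k) x y).le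
  have hw0' : ∀ x y, 0 ≤ w' x y := fun x y => (liftedMobility_pos hε (hm' k) x y).le
  set u := C.pairing (φ k) p with hu
  set u' := C.pairing (φ (k + 1)) p with hu'
  set e := C.energy w (φ k) (φ k) with he
  set e' := C.energy w' (φ (k + 1)) (φ (k + 1)) with he'
  have hνx : ∀ x, m k x + m' k x = ν x + A x := fun x => congrFun hν x
  have hν'x : ∀ x, ν' x = ν x + A x + B x := fun x => congrFun hν' x
  have hlow : ∀ s ∈ Icc (0 : ℝ) 1, ∀ x, (m k x + ε) + (m' k x + ε)
      ≤ (ν + q • p) x + s * ((ν' + q • p) x - (ν + q • p) x) := by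
    intro s hs x
    simp only [Pi.add_apply, Pi.smul_apply, smul_eq_mul]
    have h1 := hνx x
    have h2 := hν'x x
    have h3 := abs_le.1 (hAε x)
    have h4 := abs_le.1 (hBε x)
    have h5 := hq x
    have h6 : (1 - s) * A x ≤ (1 - s) * ε :=
      mul_le_mul_of_nonneg_left h3.2 (sub_nonneg.2 hs.2)
    have h7 : s * -ε ≤ s * B x := mul_le_mul_of_nonneg_left h4.1 hs.1
    rw [h2]
    linarith
  have hpos : ∀ x, 0 < (m k x + ε) + (m' k x + ε) := fun x => by
    have := hm k x
    have := hm' k x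
    linarith
  -- The part of the increment that is transported rather than created.
  set F : X → ℝ := τ • ((1 / b ^ 2) • C.flow w (φ k) + (1 / b ^ 2) • C.flow w' (φ (k + 1)))
    with hF
  have hFη : ∀ η, C.pairing F η
      = -(C.energy w ((τ / b ^ 2) • φ k) η + C.energy w' ((τ / b ^ 2) • φ (k + 1)) η) := by
    intro η
    rw [C.pairing_comm, hF, pairing_smul_right, pairing_add_right, pairing_smul_right,
      pairing_smul_right, pairing_flow, pairing_flow, energy_smul_left, energy_smul_left]
    ring
  have hJ : C.Joins a b p (lam / n) (ν + q • p) (ν' + q • p)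
      ((a ^ 2 * (τ * (1 / (2 * a ^ 2)) * (u + u')) ^ 2
        + b ^ 2 * ((τ / b ^ 2) ^ 2 * (e + e'))) / (lam / n)) := by
    refine joins_step (F := F) (by positivity) (fun x => ?_) (fun x => ?_) (fun x => ?_) ?_ ?_
    · have := hlow 0 ⟨le_rfl, zero_le_one⟩ x
      rw [zero_mul, add_zero] at this
      exact (hpos x).trans_le this
    · have := hlow 1 ⟨zero_le_one, le_rfl⟩ x
      rw [one_mul, add_sub_cancel] at this
      exact (hpos x).trans_le this
    · simp only [Pi.add_apply, hν'x, hA, hB, halfStep, hF, Pi.smul_apply, Pi.sub_apply,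
        smul_eq_mul]
      ring
    · rw [hF, pairing_smul_right, pairing_add_right, pairing_smul_right, pairing_smul_right,
        pairing_one_flow, pairing_one_flow]
      ring
    -- Young's inequality for each half step, then superadditivity of the mobility.
    · intro s hs η
      have h1 := C.two_mul_energy_le hw0 ((τ / b ^ 2) • φ k) η
      have h2 := C.two_mul_energy_le hw0' ((τ / b ^ 2) • φ (k + 1)) η
      have h3 : C.energy w η η + C.energy w' η η ≤ C.energy (mobility fun x =>
          (ν + q • p) x + s * ((ν' + q • p) x - (ν + q • p) x)) η η := by
        rw [← energy_weight_add]
        refine C.energy_mono (fun x y => ?_) η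
        refine (mobility_superadditive (fun x => add_nonneg (hm k x) hε.le)
          (fun x => add_nonneg (hm' k x) hε.le) x y).trans ?_
        exact mobility_mono (fun x => (hpos x).le) (hlow s hs) x y
      have e1 : C.energy w ((τ / b ^ 2) • φ k) ((τ / b ^ 2) • φ k) = (τ / b ^ 2) ^ 2 * e := by
        rw [energy_smul_left, energy_smul_right]; ring
      have e2 : C.energy w' ((τ / b ^ 2) • φ (k + 1)) ((τ / b ^ 2) • φ (k + 1))
          = (τ / b ^ 2) ^ 2 * e' := by
        rw [energy_smul_left, energy_smul_right]; ring
      rw [hFη]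
      linarith
  refine hJ.mono ?_
  have hx : a ^ 2 * (τ * (1 / (2 * a ^ 2)) * (u + u')) ^ 2
      ≤ τ ^ 2 * (1 / (2 * a ^ 2) * (u ^ 2 + u' ^ 2)) := by
    have h1 : a ^ 2 * (τ * (1 / (2 * a ^ 2)) * (u + u')) ^ 2
        = τ ^ 2 * (1 / (2 * a ^ 2) * ((u + u') ^ 2 / 2)) := by field_simp
    rw [h1]
    gcongr
    nlinarith [sq_nonneg (u - u')]
  have hy : b ^ 2 * ((τ / b ^ 2) ^ 2 * (e + e')) = τ ^ 2 * (1 / b ^ 2 * (e + e')) := by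
    field_simp
  have hlt : lam / n = lam * τ := div_eq_mul_inv _ _
  rw [hlt, cellForm_diag, div_le_div_iff₀ (by positivity) hlam, hy]
  calc _ ≤ (τ ^ 2 * (1 / (2 * a ^ 2) * (u ^ 2 + u' ^ 2))
        + τ ^ 2 * (1 / b ^ 2 * (e + e'))) * lam := by gcongr
    _ = _ := by ring

end RevChain

lemma exists_pos_le_of_forall_pos {X : Type*} [Fintype X] {f : X → ℝ} (hf : ∀ x, 0 < f x) :
    ∃ r > 0, ∀ x, r ≤ f x := by
  rcases isEmpty_or_nonempty X with h | h
  · exact ⟨1, one_pos, fun x => h.elim x⟩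
  · obtain ⟨x, hx⟩ := Finite.exists_min f
    exact ⟨f x, hf x, hx⟩

namespace RevChain

variable {X : Type*} [Fintype X] (C : RevChain X) {a b : ℝ} {p : X → ℝ}

lemma energy_one_right (w : X → X → ℝ) (φ : X → ℝ) : C.energy w φ 1 = 0 := by
  simp [energy, grad]

/-- The multipliers of a discrete saddle point are bounded independently of the number of cells,
because the total mass can only grow through the source, whose size the action controls. -/
lemma multiplier_le_of_saddle (ha : 0 < a) (hp : C.pairing 1 p = 1) {μ₀ : X → ℝ}
    {c ε r : ℝ} (hε : 0 < ε) (hr : 0 < r) (hrϖ : ∀ x, r ≤ C.ϖ x) {n : ℕ} (hn : 0 < n)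
    {φ m m' A B : ℕ → X → ℝ} (hm : ∀ k x, 0 ≤ m k x) (hm' : ∀ k x, 0 ≤ m' k x)
    (hA : ∀ k, A k = C.halfStep a b p (n : ℝ)⁻¹ (liftedMobility ε (m k)) (φ k))
    (hB : ∀ k, B k = C.halfStep a b p (n : ℝ)⁻¹ (liftedMobility ε (m' k)) (φ (k + 1)))
    (hcost : ∑ k ∈ Finset.range n, C.cellForm a b p n ε m m' φ φ k ≤ 2 * c)
    (hν : ∀ k < n, m k + m' k = discreteCurve μ₀ A B k + A k) {k : ℕ} (hk : k < n) (x : X) :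
    m k x + m' k x ≤ (C.pairing 1 μ₀ + 1 / (2 * a ^ 2) + c) / r := by
  have hn' : (0 : ℝ) < n := by exact_mod_cast hn
  set τ := (n : ℝ)⁻¹ with hτ
  have hτ0 : 0 < τ := by positivity
  set s : ℕ → ℝ := fun k => τ / (2 * a ^ 2) + C.cellForm a b p n ε m m' φ φ k / 2 with hs
  have hcell := C.cellForm_nonneg (a := a) (b := b) (p := p) (n := n) hε hm hm' φ
  have hs0 : ∀ k, 0 ≤ s k := fun k => by
    have := hcell k
    simp only [hs]
    positivity
  -- Transport preserves mass; `s k` bounds the mass gained in the `k`-th cell.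
  have hAm : ∀ k, C.pairing 1 (A k) = τ * (1 / (2 * a ^ 2) * C.pairing (φ k) p) := fun k => by
    rw [hA, pairing_halfStep, energy_one_right, hp]
    ring
  have hBm : ∀ k, C.pairing 1 (B k) = τ * (1 / (2 * a ^ 2) * C.pairing (φ (k + 1)) p) :=
    fun k => by
      rw [hB, pairing_halfStep, energy_one_right, hp]
      ring
  have hcellu : ∀ k, τ * (1 / (2 * a ^ 2) * (C.pairing (φ k) p ^ 2
      + C.pairing (φ (k + 1)) p ^ 2)) ≤ C.cellForm a b p n ε m m' φ φ k := fun k => by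
    rw [cellForm_diag]
    have h1 := C.energy_nonneg (fun x y => (liftedMobility_pos hε (hm k) x y).le) (φ k)
    have h2 := C.energy_nonneg (fun x y => (liftedMobility_pos hε (hm' k) x y).le) (φ (k + 1))
    refine mul_le_mul_of_nonneg_left (le_add_of_nonneg_right ?_) hτ0.le
    positivity
  have hABs : ∀ k, C.pairing 1 (A k) ≤ s k ∧ C.pairing 1 (A k) + C.pairing 1 (B k) ≤ s k := by
    intro k
    have h1 := hcellu k
    set u := C.pairing (φ k) p
    set u' := C.pairing (φ (k + 1)) p
    have hκ : 0 < τ * (1 / (2 * a ^ 2)) := by positivity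
    have e1 : s k = τ * (1 / (2 * a ^ 2)) + C.cellForm a b p n ε m m' φ φ k / 2 := by
      simp only [hs]; ring
    -- Linear terms are controlled by the quadratic action.
    have h2 : u ≤ 1 + (u ^ 2 + u' ^ 2) / 2 := by
      nlinarith [sq_nonneg (u - 1), sq_nonneg u']
    have h3 : u + u' ≤ 1 + (u ^ 2 + u' ^ 2) / 2 := by
      nlinarith [sq_nonneg (u - 1), sq_nonneg (u' - 1)]
    have h2' := mul_le_mul_of_nonneg_left h2 hκ.le
    have h3' := mul_le_mul_of_nonneg_left h3 hκ.le
    rw [hAm, hBm, e1]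
    constructor <;> linarith
  have hνm : ∀ k, C.pairing 1 (discreteCurve μ₀ A B k)
      ≤ C.pairing 1 μ₀ + ∑ j ∈ Finset.range k, s j := by
    intro k
    induction k with
    | zero => simp [discreteCurve]
    | succ k ih =>
      rw [discreteCurve, pairing_add_right, pairing_add_right, Finset.sum_range_succ]
      linarith [(hABs k).2]
  have hsum : ∑ j ∈ Finset.range n, s j ≤ 1 / (2 * a ^ 2) + c := by
    simp only [hs, Finset.sum_add_distrib, Finset.sum_const, Finset.card_range, nsmul_eq_mul,
      ← Finset.sum_div]
    have : (n : ℝ) * (τ / (2 * a ^ 2)) = 1 / (2 * a ^ 2) := by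
      rw [hτ]; field_simp
    linarith
  have hM : C.pairing 1 (m k + m' k) ≤ C.pairing 1 μ₀ + 1 / (2 * a ^ 2) + c := by
    rw [hν k hk, pairing_add_right]
    have h1 := Finset.sum_range_succ s k
    have h2 : ∑ j ∈ Finset.range (k + 1), s j ≤ ∑ j ∈ Finset.range n, s j :=
      Finset.sum_le_sum_of_subset_of_nonneg (Finset.range_subset_range.2 hk) fun j _ _ => hs0 j
    linarith [hνm k, (hABs k).1]
  have hMx : (m k x + m' k x) * C.ϖ x ≤ C.pairing 1 (m k + m' k) := by
    refine le_trans (le_of_eq ?_) (Finset.single_le_sum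
      (f := fun x => (1 : X → ℝ) x * (m k + m' k) x * C.ϖ x) (fun z _ => ?_) (Finset.mem_univ x))
    · simp
    · simp only [Pi.one_apply, one_mul, Pi.add_apply]
      exact mul_nonneg (add_nonneg (hm k z) (hm' k z)) (C.ϖ_nonneg z)
  rw [le_div_iff₀ hr]
  have := mul_le_mul_of_nonneg_left (hrϖ x) (add_nonneg (hm k x) (hm' k x))
  linarith

/-- If all `C¹` subsolutions have dual value at most `D < c`, then `μ₀` and `μ₁` are joined by a
curve of action close to `2c`: raise `μ₀` by `q p` during the time `δ`, follow the discrete curve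
raised by `q p`, and descend to `μ₁` during the time `δ`. -/
lemma joins_of_dualValue_le (ha : 0 < a) (hb : 0 < b) (hp : p ∈ posDensities X)
    (hp1 : C.pairing 1 p = 1) {μ₀ μ₁ : X → ℝ} (hμ₀ : ∀ x, 0 ≤ μ₀ x) (hμ₁ : ∀ x, 0 ≤ μ₁ x)
    {D c : ℝ} (hDc : D < c)
    (hD : ∀ Ψ, IsC1 1 Ψ → C.SatisfiesHJ 1 b Ψ → C.dualValue a p μ₀ μ₁ Ψ ≤ D)
    {q δ : ℝ} (hq : 0 < q) (hδ : 0 < δ) (hδ2 : 2 * δ < 1) :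
    C.Joins a b p 1 μ₀ μ₁ (a ^ 2 * q ^ 2 / δ + 2 * c / (1 - 2 * δ) + a ^ 2 * q ^ 2 / δ) := by
  obtain ⟨r, hr, hrϖ⟩ := exists_pos_le_of_forall_pos C.ϖ_pos
  obtain ⟨ρ, hρ, hρp⟩ := exists_pos_le_of_forall_pos (f := p) hp
  have hp0 : ∀ x, 0 ≤ p x := fun x => (hp x).le
  set P := ∑ x, p x
  have hP : ∀ x, p x ≤ P := fun x =>
    Finset.single_le_sum (fun z _ => hp0 z) (Finset.mem_univ x)
  set ε := q * ρ / 3 with hεd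
  have hε : 0 < ε := by positivity
  have hqp : ∀ x, 3 * ε ≤ q * p x := fun x => by
    have := mul_le_mul_of_nonneg_left (hρp x) hq.le
    rw [hεd]; linarith
  -- `mbar` bounds the multipliers, `W` the weights, and `Q / n` the squares of the half steps, so
  -- that `n` can be chosen to make the half steps smaller than `ε`.
  set mbar := (C.pairing 1 μ₀ + 1 / (2 * a ^ 2) + c) / r with hmbar
  set W := 2 * (mbar + ε) with hW
  set Q := 2 * c * P ^ 2 / a ^ 2 + 2 * (2 * c) * W / (r ^ 2 * b ^ 2) with hQ
  obtain ⟨n₀, hn₀⟩ := exists_nat_gt (Q / ε ^ 2)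
  set n := n₀ + 1 with hnd
  have hn : 0 < n := Nat.succ_pos _
  have hn' : (0 : ℝ) < n := by exact_mod_cast hn
  have hsmall : (n : ℝ)⁻¹ * Q ≤ ε ^ 2 := by
    rw [inv_mul_le_iff₀ hn']
    rw [div_lt_iff₀ (by positivity)] at hn₀
    have : (n : ℝ) = n₀ + 1 := by rw [hnd]; push_cast; ring
    rw [this]
    nlinarith [sq_nonneg ε]
  obtain ⟨φ, m, m', hm, hm', hstat, hcost⟩ :=
    C.exists_discrete_saddle ha hb hp1 μ₀ μ₁ hDc hD hn hε
  set A : ℕ → X → ℝ := fun k => C.halfStep a b p (n : ℝ)⁻¹ (liftedMobility ε (m k)) (φ k)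
    with hA
  set B : ℕ → X → ℝ := fun k =>
    C.halfStep a b p (n : ℝ)⁻¹ (liftedMobility ε (m' k)) (φ (k + 1)) with hB
  obtain ⟨hend, hmid⟩ := C.discreteCurve_of_stationary (A := A) (B := B) fun η => by
    rw [hstat]
    refine Finset.sum_congr rfl fun k _ => ?_
    simp only [hA, hB, pairing_halfStep, cellForm]
    ring
  set ν := discreteCurve μ₀ A B with hν
  have hcell0 := C.cellForm_nonneg (a := a) (b := b) (p := p) (n := n) hε hm hm' φ
  have hcell : ∀ k < n, C.cellForm a b p n ε m m' φ φ k ≤ 2 * c := fun k hk =>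
    (Finset.single_le_sum (fun j _ => hcell0 j) (Finset.mem_range.2 hk)).trans hcost
  have hmle : ∀ k < n, ∀ x, m k x + m' k x ≤ mbar := fun k hk x =>
    C.multiplier_le_of_saddle ha hp1 hε hr hrϖ hn hm hm' (fun _ => rfl) (fun _ => rfl) hcost
      hmid hk x
  have hWle : ∀ f : X → ℝ, (∀ x, 0 ≤ f x) → (∀ x, f x ≤ mbar) →
      ∀ x y, liftedMobility ε f x y ≤ W := fun f hf0 hf x y =>
    (logMean_le_add (add_nonneg (hf0 x) hε.le) (add_nonneg (hf0 y) hε.le)).trans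
      (by linarith [hf x, hf y])
  have hhalf : ∀ k < n, (∀ x, |A k x| ≤ ε) ∧ ∀ x, |B k x| ≤ ε := by
    intro k hk
    have h0 := hcell k hk
    rw [cellForm_diag] at h0
    have hw := fun x y => (liftedMobility_pos hε (hm k) x y).le
    have hw' := fun x y => (liftedMobility_pos hε (hm' k) x y).le
    have h1 := C.energy_nonneg hw (φ k)
    have h2 := C.energy_nonneg hw' (φ (k + 1))
    have hτ : 0 ≤ (n : ℝ)⁻¹ := by positivity
    have t1 : 0 ≤ (n : ℝ)⁻¹ * (1 / (2 * a ^ 2) * C.pairing (φ k) p ^ 2) := by positivity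
    have t2 : 0 ≤ (n : ℝ)⁻¹ * (1 / (2 * a ^ 2) * C.pairing (φ (k + 1)) p ^ 2) := by positivity
    have t3 : 0 ≤ (n : ℝ)⁻¹ * (1 / b ^ 2 * C.energy (liftedMobility ε (m k)) (φ k) (φ k)) := by
      positivity
    have t4 : 0 ≤ (n : ℝ)⁻¹ * (1 / b ^ 2 *
        C.energy (liftedMobility ε (m' k)) (φ (k + 1)) (φ (k + 1))) := by positivity
    simp only [mul_add] at h0
    exact ⟨C.abs_halfStep_le ha hb hτ hr hrϖ hp0 hP hε.le hw
        (hWle _ (hm k) fun x => by linarith [hmle k hk x, hm' k x]) (Γ := 2 * c)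
        (by linarith) (by linarith) hsmall,
      C.abs_halfStep_le ha hb hτ hr hrϖ hp0 hP hε.le hw'
        (hWle _ (hm' k) fun x => by linarith [hmle k hk x, hm k x]) (Γ := 2 * c)
        (by linarith) (by linarith) hsmall⟩
  set lam := 1 - 2 * δ with hlam
  have hlam0 : 0 < lam := by rw [hlam]; linarith
  have hqp0 : ∀ x, 0 ≤ (q • p) x := fun x => mul_nonneg hq.le (hp0 x)
  have hpath : ∀ k ≤ n, C.Joins a b p (δ + k * (lam / n)) μ₀ (ν k + q • p)
      (a ^ 2 * q ^ 2 / δ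
        + ∑ j ∈ Finset.range k, C.cellForm a b p n ε m m' φ φ j / lam) := by
    intro k
    induction k with
    | zero =>
      intro _
      simp only [Nat.cast_zero, zero_mul, add_zero, Finset.range_zero, Finset.sum_empty]
      exact joins_source hδ hμ₀ (fun x => add_nonneg (hμ₀ x) (hqp0 x)) fun x => by
        simp [hν, discreteCurve]
    | succ k ih =>
      intro hk
      have hk : k < n := hk
      have h1 := C.joins_cell ha hb hn hε hlam0 hqp hm hm' (k := k) (A := A k) (B := B k)
        (ν := ν k) (ν' := ν (k + 1)) rfl rfl (hmid k hk) rfl (hhalf k hk).1 (hhalf k hk).2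
      have h2 := (ih hk.le).trans (by positivity) (by positivity)
        (add_nonneg (by positivity) (Finset.sum_nonneg fun j _ =>
          div_nonneg (hcell0 j) hlam0.le)) (div_nonneg (hcell0 k) hlam0.le) h1
      rw [Finset.sum_range_succ, ← add_assoc]
      have e : δ + ((k + 1 : ℕ) : ℝ) * (lam / n) = δ + k * (lam / n) + lam / n := by
        push_cast; ring
      rw [e]
      exact h2
  have hc0 : 0 ≤ 2 * c := (Finset.sum_nonneg fun j _ => hcell0 j).trans hcost
  have h1 : C.Joins a b p (δ + n * (lam / n)) μ₀ (ν n + q • p)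
      (a ^ 2 * q ^ 2 / δ + 2 * c / lam) := by
    refine (hpath n le_rfl).mono ?_
    rw [← Finset.sum_div]
    gcongr
  have h2 : C.Joins a b p δ (ν n + q • p) μ₁ (a ^ 2 * q ^ 2 / δ) := by
    have : C.Joins a b p δ (ν n + q • p) μ₁ (a ^ 2 * (-q) ^ 2 / δ) := by
      rw [hend]
      refine joins_source hδ (fun x => add_nonneg (hμ₁ x) (hqp0 x)) hμ₁ fun x => ?_
      simp
    rwa [neg_sq] at this
  have h3 := h1.trans (by positivity) hδ.le (by positivity) (by positivity) h2
  have e : δ + n * (lam / n) + δ = 1 := by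
    rw [mul_div_cancel₀ _ hn'.ne', hlam]; ring
  rwa [e] at h3

/-- The upper bound in the duality formula: the minimal action is at most twice any upper bound
for the dual values of the `C¹` subsolutions. -/
lemma iInf_action_le_of_dualValue_le (ha : 0 < a) (hb : 0 < b) (hp : p ∈ posDensities X)
    (hp1 : C.pairing 1 p = 1) {μ₀ μ₁ : X → ℝ} (hμ₀ : ∀ x, 0 ≤ μ₀ x) (hμ₁ : ∀ x, 0 ≤ μ₁ x)
    {D : ℝ} (hD : ∀ Ψ, IsC1 1 Ψ → C.SatisfiesHJ 1 b Ψ → C.dualValue a p μ₀ μ₁ Ψ ≤ D) :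
    (⨅ (μ : ℝ → X → ℝ) (ψ : ℝ → X → ℝ) (h : ℝ → ℝ) (_ : C.IsAdmissible p μ₀ μ₁ μ ψ h),
      C.action a b μ ψ h) ≤ ENNReal.ofReal (2 * D) := by
  set I := ⨅ (μ : ℝ → X → ℝ) (ψ : ℝ → X → ℝ) (h : ℝ → ℝ)
    (_ : C.IsAdmissible p μ₀ μ₁ μ ψ h), C.action a b μ ψ h
  -- Choose `q = δ` and `c = D + δ`, and let `δ → 0`.
  have hle : ∀ᶠ δ in nhdsWithin (0 : ℝ) (Ioi 0), I ≤ ENNReal.ofReal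
      (a ^ 2 * δ + 2 * (D + δ) / (1 - 2 * δ) + a ^ 2 * δ) := by
    filter_upwards [Ioo_mem_nhdsGT (show (0 : ℝ) < 1 / 2 by norm_num)] with δ hδ
    have h := C.joins_of_dualValue_le ha hb hp hp1 hμ₀ hμ₁ (lt_add_of_pos_right D hδ.1) hD hδ.1
      hδ.1 (by linarith [hδ.2])
    have e : a ^ 2 * δ ^ 2 / δ = a ^ 2 * δ := by
      have := hδ.1.ne'
      field_simp
    rw [e] at h
    exact C.iInf_action_le h
  have hcont : ContinuousAt (fun δ : ℝ => ENNReal.ofReal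
      (a ^ 2 * δ + 2 * (D + δ) / (1 - 2 * δ) + a ^ 2 * δ)) 0 := by
    refine ENNReal.continuous_ofReal.continuousAt.comp ?_
    refine ContinuousAt.add (ContinuousAt.add (by fun_prop) (ContinuousAt.div (by fun_prop)
      (by fun_prop) (by norm_num))) (by fun_prop)
  have hlim := ge_of_tendsto (hcont.tendsto.mono_left nhdsWithin_le_nhds) hle
  simpa using hlim

end RevChain

/-! ### Weak duality and the duality formula -/

lemma MeasureTheory.Integrable.ofReal_integral_le {α : Type*} [MeasurableSpace α] {μ : Measure α}
    {f : α → ℝ} (hf : Integrable f μ) :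
    ENNReal.ofReal (∫ x, f x ∂μ) ≤ ∫⁻ x, ENNReal.ofReal (f x) ∂μ := by
  rw [integral_eq_lintegral_pos_part_sub_lintegral_neg_part hf]
  exact (ENNReal.ofReal_le_ofReal (sub_le_self _ ENNReal.toReal_nonneg)).trans
    ENNReal.ofReal_toReal_le

lemma IsC1.isH1 {X : Type*} {φ : ℝ → X → ℝ} (hφ : IsC1 1 φ) : IsH1 1 φ := by
  intro x
  have h := hφ x
  rw [← uIcc_of_le (zero_le_one' ℝ)] at h
  refine ⟨h.absolutelyContinuousOnInterval, ?_⟩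
  obtain ⟨K, hK⟩ := h.exists_lipschitzOnWith (by decide) (convex_uIcc _ _) isCompact_uIcc
  rw [uIcc_of_le (zero_le_one' ℝ)] at hK
  refine MemLp.of_bound (measurable_deriv _).aestronglyMeasurable K ?_
  filter_upwards [ae_restrict_mem measurableSet_Ioo] with t ht
  exact norm_deriv_le_of_lipschitzOn (Icc_mem_nhds ht.1 ht.2) hK

namespace RevChain

variable {X : Type*} [Fintype X] (C : RevChain X) {a b : ℝ} {p : X → ℝ}

/-- The infinitesimal form of weak duality: along an admissible triple, the Hamilton–Jacobi
inequality bounds `d/dt ⟨φ_t, μ_t⟩ - ⟨φ_t, p⟩² / (2a²)` by half the action density. -/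
lemma two_mul_rate_le (ha : 0 < a) (hb : 0 < b) {μ μ' φ φ' ψ : X → ℝ} {h : ℝ}
    (hμ : ∀ x, 0 ≤ μ x)
    (hce : ∀ x, μ' x + C.divergence (fun y z => mobility μ y z * grad ψ y z) x = h * p x)
    (hHJ : C.pairing φ' μ + 1 / (2 * b ^ 2) * C.normMu μ (grad φ) ^ 2 ≤ 0) :
    2 * (C.pairing φ' μ + C.pairing φ μ' - 1 / (2 * a ^ 2) * C.pairing φ p ^ 2)
      ≤ a ^ 2 * h ^ 2 + b ^ 2 * C.normMu μ (grad ψ) ^ 2 := by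
  have e : μ' = h • p - C.flow (mobility μ) ψ := by
    funext x
    exact eq_sub_of_add_eq (hce x)
  have hw := mobility_nonneg hμ
  rw [e, pairing_sub_right, pairing_smul_right, pairing_flow, C.normMu_sq hμ]
  rw [C.normMu_sq hμ] at hHJ
  have h1 := C.two_mul_energy_le hw (b • ψ) (b⁻¹ • φ)
  simp only [energy_smul_left, energy_smul_right] at h1
  have h2 : 2 * (h * C.pairing φ p) ≤ a ^ 2 * h ^ 2 + C.pairing φ p ^ 2 / a ^ 2 := by
    have := sq_nonneg (a * h - C.pairing φ p / a)
    have e : (a * h - C.pairing φ p / a) ^ 2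
        = a ^ 2 * h ^ 2 - 2 * (h * C.pairing φ p) + C.pairing φ p ^ 2 / a ^ 2 := by
      field_simp
      ring
    linarith
  have e1 : b * (b⁻¹ * C.energy (mobility μ) ψ φ) = C.energy (mobility μ) ψ φ := by
    field_simp
  have e2 : 1 / (2 * b ^ 2) * C.energy (mobility μ) φ φ
      = 1 / 2 * (b⁻¹ * (b⁻¹ * C.energy (mobility μ) φ φ)) := by
    field_simp
  have e3 : 1 / (2 * a ^ 2) * C.pairing φ p ^ 2 = 1 / 2 * (C.pairing φ p ^ 2 / a ^ 2) := by
    field_simp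
  have h3 : 2 * C.energy (mobility μ) ψ φ
      ≤ b ^ 2 * C.energy (mobility μ) ψ ψ + b⁻¹ * (b⁻¹ * C.energy (mobility μ) φ φ) := by
    linarith
  rw [e2] at hHJ
  rw [e3]
  linarith

/-- Integration by parts in time for the pairing of two absolutely continuous curves. -/
lemma integral_pairing_deriv {φ μ : ℝ → X → ℝ}
    (hφ : ∀ x, AbsolutelyContinuousOnInterval (fun t => φ t x) 0 1)
    (hμ : ∀ x, AbsolutelyContinuousOnInterval (fun t => μ t x) 0 1) :
    IntervalIntegrable (fun t => C.pairing (fun x => deriv (fun s => φ s x) t) (μ t)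
        + C.pairing (φ t) (fun x => deriv (fun s => μ s x) t)) volume 0 1 ∧
      ∫ t in (0 : ℝ)..1, (C.pairing (fun x => deriv (fun s => φ s x) t) (μ t)
        + C.pairing (φ t) (fun x => deriv (fun s => μ s x) t))
        = C.pairing (φ 1) (μ 1) - C.pairing (φ 0) (μ 0) := by
  have hi : ∀ x, IntervalIntegrable (fun t => (deriv (fun s => φ s x) t * μ t x
      + φ t x * deriv (fun s => μ s x) t) * C.ϖ x) volume 0 1 := fun x =>
    (((hφ x).intervalIntegrable_deriv.mul_continuousOn (hμ x).continuousOn).add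
      ((hμ x).intervalIntegrable_deriv.continuousOn_mul (hφ x).continuousOn)).mul_const _
  have e : (fun t => C.pairing (fun x => deriv (fun s => φ s x) t) (μ t)
        + C.pairing (φ t) (fun x => deriv (fun s => μ s x) t))
      = fun t => ∑ x, (deriv (fun s => φ s x) t * μ t x
        + φ t x * deriv (fun s => μ s x) t) * C.ϖ x := by
    funext t
    simp only [pairing, ← Finset.sum_add_distrib, add_mul]
  rw [e]
  constructor
  · rw [intervalIntegrable_iff]
    exact integrable_finsetSum _ fun x _ => (intervalIntegrable_iff.1 (hi x))
  · rw [intervalIntegral.integral_finsetSum fun x _ => hi x]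
    simp only [intervalIntegral.integral_mul_const, (hφ _).integral_deriv_mul_eq_sub (hμ _),
      sub_mul, Finset.sum_sub_distrib, pairing]

/-- Weak duality: twice the dual value of any subsolution is at most the action of any admissible
triple. -/
lemma dualValue_le_action (ha : 0 < a) (hb : 0 < b) {μ₀ μ₁ : X → ℝ} {φ : ℝ → X → ℝ}
    (hφ : φ ∈ C.HJ 1 b) {μ ψ : ℝ → X → ℝ} {h : ℝ → ℝ} (hadm : C.IsAdmissible p μ₀ μ₁ μ ψ h) :
    ENNReal.ofReal (2 * C.dualValue a p μ₀ μ₁ φ) ≤ C.action a b μ ψ h := by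
  obtain ⟨hH1, hHJ⟩ := hφ
  obtain ⟨hint, hval⟩ := C.integral_pairing_deriv (fun x => (hH1 x).1) hadm.absCont
  set g' : ℝ → ℝ := fun t => C.pairing (fun x => deriv (fun s => φ s x) t) (μ t)
        + C.pairing (φ t) (fun x => deriv (fun s => μ s x) t) with hg'
  have hF : IntervalIntegrable (fun t => C.pairing (φ t) p ^ 2) volume 0 1 := by
    refine ContinuousOn.intervalIntegrable (ContinuousOn.pow ?_ 2)
    exact continuousOn_finsetSum _ fun x _ =>
      ((hH1 x).1.continuousOn.mul continuousOn_const).mul continuousOn_const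
  have hF' := hF.const_mul (1 / (2 * a ^ 2))
  have e : 2 * C.dualValue a p μ₀ μ₁ φ
      = ∫ t in Ioc (0 : ℝ) 1, 2 * (g' t - 1 / (2 * a ^ 2) * C.pairing (φ t) p ^ 2) := by
    rw [← intervalIntegral.integral_of_le zero_le_one, intervalIntegral.integral_const_mul,
      intervalIntegral.integral_sub hint hF', hval, intervalIntegral.integral_const_mul,
      hadm.start, hadm.finish, dualValue]
  have hI : Integrable (fun t => 2 * (g' t - 1 / (2 * a ^ 2) * C.pairing (φ t) p ^ 2))
      (volume.restrict (Ioc (0 : ℝ) 1)) :=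
    ((intervalIntegrable_iff_integrableOn_Ioc_of_le zero_le_one).1 ((hint.sub hF').const_mul 2))
  rw [e]
  refine hI.ofReal_integral_le.trans ?_
  have hmeas : Measurable fun t => ENNReal.ofReal (h t ^ 2) :=
    (hadm.measurable_h.pow_const 2).ennreal_ofReal
  rw [action, ← lintegral_const_mul _ hmeas, ← lintegral_const_mul' _ _ ENNReal.ofReal_ne_top,
    ← lintegral_add_left (hmeas.const_mul _), restrict_Ioc_eq_restrict_Icc]
  refine lintegral_mono_ae ?_
  have hHJ' := hHJ
  rw [SatisfiesHJ, restrict_Ioo_eq_restrict_Icc] at hHJ'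
  filter_upwards [hHJ', hadm.continuity_eq, ae_restrict_mem measurableSet_Icc] with t h1 h2 ht
  have hμ := hadm.nonneg t ht
  rw [← ENNReal.ofReal_mul (by positivity), ← ENNReal.ofReal_mul (by positivity),
    ← ENNReal.ofReal_add (by positivity) (by positivity)]
  exact ENNReal.ofReal_le_ofReal (C.two_mul_rate_le ha hb hμ h2 (h1 _ hμ))

end RevChain

end

theorem mainTheorem2 {X : Type*} [Fintype X] (C : RevChain X) (a b : ℝ) (ha : 0 < a) (hb : 0 < b)
    (p : X → ℝ) (hp : p ∈ posDensities X) (hp1 : C.l1Norm p = 1)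
    (μ₀ μ₁ : X → ℝ) (hμ₀ : μ₀ ∈ nonnegDensities X) (hμ₁ : μ₁ ∈ nonnegDensities X) :
    C.dist a b p μ₀ μ₁ ≠ ⊤ ∧
    IsLUB (C.dualValue a p μ₀ μ₁ '' C.HJ 1 b)
      (1 / 2 * (C.dist a b p μ₀ μ₁).toReal ^ 2) ∧
    IsLUB (C.dualValue a p μ₀ μ₁ '' {φ | IsC1 1 φ ∧ C.SatisfiesHJ 1 b φ})
      (1 / 2 * (C.dist a b p μ₀ μ₁).toReal ^ 2) := by
  rw [RevChain.dist]
  set I : ℝ≥0∞ := ⨅ (μ : ℝ → X → ℝ) (ψ : ℝ → X → ℝ) (h : ℝ → ℝ)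
    (_ : C.IsAdmissible p μ₀ μ₁ μ ψ h), C.action a b μ ψ h with hIdef
  have hI : I ≠ ⊤ := by
    obtain ⟨A, hA⟩ := C.exists_joins a b hp hp1 hμ₀ hμ₁
    exact ne_top_of_le_ne_top ENNReal.ofReal_ne_top (C.iInf_action_le hA)
  have hsq : (I ^ (1 / 2 : ℝ)).toReal ^ 2 = I.toReal := by
    rw [← ENNReal.toReal_pow, ← ENNReal.rpow_natCast, ← ENNReal.rpow_mul]
    norm_num
  have hsub : {φ | IsC1 1 φ ∧ C.SatisfiesHJ 1 b φ} ⊆ C.HJ 1 b := fun φ hφ =>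
    ⟨hφ.1.isH1, hφ.2⟩
  have hweak : 1 / 2 * I.toReal ∈ upperBounds (C.dualValue a p μ₀ μ₁ '' C.HJ 1 b) := by
    rintro _ ⟨φ, hφ, rfl⟩
    have h : ENNReal.ofReal (2 * C.dualValue a p μ₀ μ₁ φ) ≤ I :=
      le_iInf₂ fun μ ψ => le_iInf₂ fun h hadm => C.dualValue_le_action ha hb hφ hadm
    linarith [(ENNReal.ofReal_le_iff_le_toReal hI).1 h]
  have hstrong : ∀ D ∈ upperBounds
      (C.dualValue a p μ₀ μ₁ '' {φ | IsC1 1 φ ∧ C.SatisfiesHJ 1 b φ}),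
      1 / 2 * I.toReal ≤ D := by
    intro D hD
    -- The zero function is a subsolution of dual value `0`.
    have hD0 : 0 ≤ D := by
      refine hD ⟨0, ⟨fun x => contDiffOn_const, .of_forall fun t μ hμ => ?_⟩, ?_⟩
      · rw [C.normMu_sq hμ]
        simp [RevChain.pairing, RevChain.energy, grad]
      · simp [RevChain.dualValue, RevChain.pairing]
    have h := C.iInf_action_le_of_dualValue_le ha hb hp (C.pairing_one_eq_one hp hp1) hμ₀ hμ₁
      fun Ψ h1 h2 => hD ⟨Ψ, ⟨h1, h2⟩, rfl⟩
    linarith [ENNReal.toReal_le_of_le_ofReal (by positivity) h]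
  rw [hsq]
  exact ⟨ENNReal.rpow_ne_top_of_nonneg (by norm_num) hI,
    ⟨hweak, fun D hD => hstrong D (upperBounds_mono_set (image_mono hsub) hD)⟩,
    ⟨upperBounds_mono_set (image_mono hsub) hweak, hstrong⟩⟩
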